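/- Let $d\in\mathbb N$ and let $\{X_{nj} : n\in\mathbb N,\ j\in\mathbb Z^d\}$ be real random variables with mean zero on a probability space $(\Omega,\mathcal F,P)$ such that, for each $n$, the variables $X_{nj}$, $j\in\mathbb Z^d$, are independent. Suppose that for each $n$ there is $H_n>0$ such that, for every $j$, $E e^{zX_{nj}}$ is finite for $|z|<H_n$, $z\in\mathbb C$, and the cumulant generating function $L_{nj}(z)=\log E e^{zX_{nj}}$ (with the branch of the logarithm for which $L_{nj}(0)=0$) is analytic in the disc $|z|<H_n$. Let $\gamma_{3nj}=L_{nj}'''(0)$ be the third cumulant of $X_{nj}$. Assume that $$B_n=\sum_{j\in\mathbb Z^d}E X_{nj}^2<\infty$$ and that the sum $S_n=\sum_{j\in\mathbb Z^d}X_{nj}$ is well defined as the limit (in probability) of $\sum_{j\in[-m,m]^d\cap\mathbb Z^d}X_{nj}$ as $m\to\infty$. Put $F_n(x)=P(S_n<x\sqrt{B_n})$, and let $\Phi$ be the standard normal distribution function. Suppose that there are constants $c_{nj}\ge 0$ with $|L_{nj}(z)|\le c_{nj}$ for all $z\in\mathbb C$ with $|z|<H_n$, that $C_n:=\sum_{j\in\mathbb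 Z^d}c_{nj}<\infty$ for every $n$, that $B_nH_n^2\to\infty$, and that $C_n=O(B_nH_n^2)$ as $n\to\infty$. Then $\sum_{j\in\mathbb Z^d}\gamma_{3nj}$ converges absolutely for every $n$, and for $x\ge 0$ with $x=O\big((H_n\sqrt{B_n})^{1/3}\big)$, $$1-F_n(x)=(1-\Phi(x))\exp\Big\{\frac{x^3}{6B_n^{3/2}}\sum_{j\in\mathbb Z^d}\gamma_{3nj}\Big\}+O\Big(\frac{e^{-x^2/2}}{H_n\sqrt{B_n}}\Big);$$ that is, for every $K$ there is $M$ such that, for all sufficiently large $n$ and all $x$ with $0\le x\le K(H_n\sqrt{B_n})^{1/3}$, the two sides without the error term differ by at most $M e^{-x^2/2}/(H_n\sqrt{B_n})$. -/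

import Mathlib

open MeasureTheory ProbabilityTheory Filter Topology

/-- The cube `Γ^d_m = [-m, m]^d ∩ ℤ^d`. -/
noncomputable def latticeCube (d m : ℕ) : Finset (Fin d → ℤ) :=
  Finset.Icc (fun _ => -(m : ℤ)) (fun _ => (m : ℤ))

/-- `S = ∑_{j ∈ ℤ^d} X j`, as the limit of the sums over the cubes `Γ^d_m`. The limit is taken in
probability, the weakest of the usual modes: an almost sure limit or an `L²` limit qualifies too. -/
def IsLatticeSum {Ω : Type*} [MeasurableSpace Ω] {d : ℕ} (X : (Fin d → ℤ) → Ω → ℝ)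
    (P : Measure Ω) (S : Ω → ℝ) : Prop :=
  TendstoInMeasure P (fun (m : ℕ) ω => ∑ j ∈ latticeCube d m, X j ω) atTop S

/-- `E e^{zX}` is finite in the disc `|z| < H` and `L(z) = log E e^{zX}` is analytic there, with the
branch of the logarithm for which `L(0) = 0`. -/
structure IsAnalyticCGF {Ω : Type*} [MeasurableSpace Ω] (X : Ω → ℝ) (P : Measure Ω)
    (H : ℝ) (L : ℂ → ℂ) : Prop where
  integrable_exp : ∀ t : ℝ, |t| < H → Integrable (fun ω => Real.exp (t * X ω)) P
  analytic : AnalyticOnNhd ℂ L (Metric.ball 0 H)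
  map_zero : L 0 = 0
  exp_eq : ∀ z ∈ Metric.ball (0 : ℂ) H, Complex.exp (L z) = complexMGF X P z

/-- The principal logarithm of `E e^{zX}` satisfies the definition whenever it is analytic in the
disc. -/
theorem IsAnalyticCGF.of_log {Ω : Type*} [MeasurableSpace Ω] {X : Ω → ℝ} {P : Measure Ω}
    [IsProbabilityMeasure P] {H : ℝ} (hH : 0 < H)
    (hint : ∀ t : ℝ, |t| < H → Integrable (fun ω => Real.exp (t * X ω)) P)
    (han : AnalyticOnNhd ℂ (fun z => Complex.log (complexMGF X P z)) (Metric.ball 0 H)) :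
    IsAnalyticCGF X P H (fun z => Complex.log (complexMGF X P z)) := by
  have h0 : complexMGF X P 0 = 1 := by simp [complexMGF]
  refine ⟨hint, han, by simp [h0], fun z hz => ?_⟩
  apply Complex.exp_log
  intro hz0
  have hMan : AnalyticOnNhd ℂ (complexMGF X P) (Metric.ball 0 H) := by
    refine analyticOnNhd_complexMGF.mono fun w hw => ?_
    have hw' : |w.re| < H := lt_of_le_of_lt (Complex.abs_re_le_norm w) (by simpa using hw)
    refine mem_interior.2 ⟨Set.Ioo (-H) H, fun t ht => hint t (abs_lt.2 ht), isOpen_Ioo,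
      abs_lt.1 hw'⟩
  have hc1 : ContinuousAt (complexMGF X P) z := (hMan z hz).continuousAt
  have hc2 : ContinuousAt (fun w => Complex.exp (Complex.log (complexMGF X P w))) z :=
    (han z hz).continuousAt.cexp
  have e1 : ∀ᶠ w in 𝓝 z, ‖complexMGF X P w‖ < 1 / 2 := by
    have := hc1.norm
    exact this.eventually_lt continuousAt_const (by simp [hz0])
  have e2 : ∀ᶠ w in 𝓝 z, 1 / 2 < ‖Complex.exp (Complex.log (complexMGF X P w))‖ :=
    continuousAt_const.eventually_lt hc2.norm (by simp [hz0]; norm_num)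
  have e3 : complexMGF X P =ᶠ[𝓝 z] 0 := by
    filter_upwards [e1, e2] with w h1 h2
    by_contra hne
    rw [Complex.exp_log hne] at h2
    linarith
  have := hMan.eqOn_zero_of_preconnected_of_eventuallyEq_zero
    (convex_ball (0 : ℂ) H).isPreconnected hz e3 (Metric.mem_ball_self hH)
  simp [h0] at this

/-- The cumulant of order `k` of `X`: the `k`-th derivative at `0` of `t ↦ log E e^{tX}`. -/
noncomputable def cumulant {Ω : Type*} [MeasurableSpace Ω] (k : ℕ) (X : Ω → ℝ)
    (P : Measure Ω) : ℝ :=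
  iteratedDeriv k (cgf X P) 0

/-- `B = ∑_{j ∈ ℤ^d} Var (X j)`. -/
noncomputable def latticeVariance {Ω : Type*} [MeasurableSpace Ω] {d : ℕ}
    (X : (Fin d → ℤ) → Ω → ℝ) (P : Measure Ω) : ℝ :=
  ∑' j, variance (X j) P

/-- The normalized distribution function `F(x) = P(S < x √B)`, with strict inequality. -/
noncomputable def normalizedDF {Ω : Type*} [MeasurableSpace Ω] (S : Ω → ℝ) (B : ℝ)
    (P : Measure Ω) (x : ℝ) : ℝ :=
  P.real {ω | S ω < x * √B}

/-- The distribution function `Φ` of the standard normal law. -/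
noncomputable def stdNormalDF (x : ℝ) : ℝ :=
  cdf (gaussianReal 0 1) x

/-! Put `Z = S / √B` and `D = H √B`. The bounds `c` make `L = ∑ L_j` a uniformly convergent series
of analytic functions, and `L` is the cumulant generating function of `S`. After rescaling, the
condition `C = O(B H²)` says `|L| ≤ A D²` on `|z| < D`. Cauchy's estimates then give `L''' = O(1/D)`
and `L'''' = O(1/D²)` on the half disc. With `L(0) = L'(0) = 0` and `L''(0) = 1`, the whole theorem
becomes a statement about one variable `Z` and one large parameter `D`.

For that variable use Cramér's change of measure, tilting by `x` itself instead of by the saddle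
point. If `Q` is the tilted law and `k` the real cumulant generating function, then `P(Z ≥ x) =
e^{k(x) - x²} ∫_{y ≥ x} e^{-x(y - x)} dQ(y)`. The law `Q` has mean `k'(x) = x + O(x²/D)` and
variance `k''(x) = 1 + O(x/D)`. Esseen's smoothing inequality places it within `O(1/D)` of the
Gaussian law with these parameters (`exists_berryEsseen_tiltedLaw`). Replacing that Gaussian by the
one with mean `x` and variance 1 costs another `O(1/D)` when `x³ = O(D)`, and turns the integral
into `ψ(x) = e^{x²/2} (1 - Φ(x))`.

Finally `k(x) = x²/2 + γ x³/6 + r` with `r = O(x⁴/D²)`. This `r` need not be `O(1/D)`, but it is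
multiplied by `ψ(x) ≤ 1/x`, and `x³/D² = O(1/D)`. The pieces are assembled in
`exists_largeDeviation`; `IsLatticeSum.isAnalyticCGF` supplies the passage to infinite sums. -/

/-! ### Fejér kernel and Esseen's smoothing inequality. -/

/-- The Fejér kernel `∫₀¹ (1 - t) cos (t v) dt`. -/
noncomputable def fejerKernel (v : ℝ) : ℝ :=
  ∫ t in (0 : ℝ)..1, (1 - t) * Real.cos (t * v)

theorem fejerKernel_zero : fejerKernel 0 = 1 / 2 := by
  simp only [fejerKernel, mul_zero, Real.cos_zero, mul_one]
  rw [intervalIntegral.integral_sub (by simp) (by simp)]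
  simp
  norm_num

theorem fejerKernel_eq {v : ℝ} (hv : v ≠ 0) : fejerKernel v = (1 - Real.cos v) / v ^ 2 := by
  have h : ∀ t ∈ Set.uIcc (0 : ℝ) 1, HasDerivAt
      (fun t => (1 - t) * (Real.sin (t * v) / v) - Real.cos (t * v) / v ^ 2)
      ((1 - t) * Real.cos (t * v)) t := by
    intro t _
    have h0 : HasDerivAt (fun t : ℝ => t * v) v t := by simpa using (hasDerivAt_id t).mul_const v
    have h1 := (((hasDerivAt_id t).const_sub 1).mul (h0.sin.div_const v)).sub
      (h0.cos.div_const (v ^ 2))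
    convert! h1 using 1
    simp
    field_simp
    ring
  rw [fejerKernel, intervalIntegral.integral_eq_sub_of_hasDerivAt h
    (by apply Continuous.intervalIntegrable; fun_prop)]
  simp
  ring

theorem fejerKernel_nonneg (v : ℝ) : 0 ≤ fejerKernel v := by
  rcases eq_or_ne v 0 with rfl | hv
  · rw [fejerKernel_zero]; norm_num
  · rw [fejerKernel_eq hv]
    exact div_nonneg (sub_nonneg.2 (Real.cos_le_one v)) (sq_nonneg v)

theorem continuous_fejerKernel : Continuous fejerKernel := by
  unfold fejerKernel
  apply intervalIntegral.continuous_parametric_intervalIntegral_of_continuous'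
  fun_prop

theorem fejerKernel_le (v : ℝ) : fejerKernel v ≤ 5 * (1 + v ^ 2)⁻¹ := by
  rw [← div_eq_mul_inv]
  rcases eq_or_ne v 0 with rfl | hv
  · rw [fejerKernel_zero]; norm_num
  · have hv2 : 0 < v ^ 2 := by positivity
    rw [fejerKernel_eq hv, div_le_div_iff₀ hv2 (by positivity)]
    have h1 := Real.one_sub_sq_div_two_le_cos (x := v)
    have h2 := Real.neg_one_le_cos v
    nlinarith

theorem integrable_fejerKernel : Integrable fejerKernel := by
  refine (integrable_inv_one_add_sq.const_mul 5).mono'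
    continuous_fejerKernel.aestronglyMeasurable (ae_of_all _ fun v => ?_)
  rw [Real.norm_of_nonneg (fejerKernel_nonneg v)]
  exact fejerKernel_le v

theorem integral_fejerKernel_pos : 0 < ∫ v, fejerKernel v :=
  integral_pos_of_integrable_nonneg_nonzero (x := 0) continuous_fejerKernel
    integrable_fejerKernel fejerKernel_nonneg (by rw [fejerKernel_zero]; norm_num)

/-- Since `b sinc(tb) = sin(tb)/t`, the distribution function of the kernel is a superposition of
sines of frequency at most 1. This band limitation is why smoothing at scale `1/T` sees
characteristic functions only on `[-T, T]`. Writing `sinc` removes the singularity at `t = 0`. -/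
theorem intervalIntegral_fejerKernel (b : ℝ) :
    ∫ v in (0 : ℝ)..b, fejerKernel v =
      ∫ t in (0 : ℝ)..1, (1 - t) * (b * Real.sinc (t * b)) := by
  unfold fejerKernel
  rw [MeasureTheory.intervalIntegral_intervalIntegral_swap
    (F := fun v t : ℝ => (1 - t) * Real.cos (t * v))]
  · apply intervalIntegral.integral_congr
    intro t _
    simp only
    rw [intervalIntegral.integral_const_mul]
    congr 1
    rcases eq_or_ne t 0 with rfl | ht
    · simp
    · rw [intervalIntegral.integral_comp_mul_left _ ht]
      rcases eq_or_ne b 0 with rfl | hb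
      · simp
      · rw [Real.sinc_of_ne_zero (mul_ne_zero ht hb)]
        simp
        field_simp
  · refine IntegrableOn.mono_set (t := Set.uIcc 0 b ×ˢ Set.uIcc 0 1) ?_
      (Set.prod_mono Set.uIoc_subset_uIcc Set.uIoc_subset_uIcc)
    refine ContinuousOn.integrableOn_compact (isCompact_uIcc.prod isCompact_uIcc) ?_
    exact Continuous.continuousOn (by unfold Function.uncurry; fun_prop)

/-- The probability measure whose density is the normalized Fejér kernel. -/
noncomputable def fejerMeasure : Measure ℝ :=
  volume.withDensity fun v => ENNReal.ofReal (fejerKernel v / ∫ u, fejerKernel u)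

instance : IsProbabilityMeasure fejerMeasure := by
  refine ⟨?_⟩
  rw [fejerMeasure, withDensity_apply _ MeasurableSet.univ, Measure.restrict_univ,
    ← ofReal_integral_eq_lintegral_ofReal (integrable_fejerKernel.div_const _)
      (ae_of_all _ fun v => div_nonneg (fejerKernel_nonneg v) integral_fejerKernel_pos.le),
    integral_div, div_self integral_fejerKernel_pos.ne', ENNReal.ofReal_one]

theorem fejerMeasure_real {s : Set ℝ} (hs : MeasurableSet s) :
    fejerMeasure.real s = (∫ v in s, fejerKernel v) / ∫ u, fejerKernel u := by
  rw [measureReal_def, fejerMeasure, withDensity_apply _ hs,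
    ← ofReal_integral_eq_lintegral_ofReal (integrable_fejerKernel.div_const _).integrableOn
      (ae_of_all _ fun v => div_nonneg (fejerKernel_nonneg v) integral_fejerKernel_pos.le),
    integral_div, ENNReal.toReal_ofReal]
  exact div_nonneg (setIntegral_nonneg hs fun v _ => fejerKernel_nonneg v)
    integral_fejerKernel_pos.le

theorem fejerMeasure_real_Iio (b : ℝ) :
    fejerMeasure.real (Set.Iio b) = fejerMeasure.real (Set.Iic 0) +
      (∫ t in (0 : ℝ)..1, (1 - t) * (b * Real.sinc (t * b))) / ∫ u, fejerKernel u := by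
  have h := intervalIntegral.integral_Iic_sub_Iic (a := 0) (b := b)
    integrable_fejerKernel.integrableOn integrable_fejerKernel.integrableOn
  rw [fejerMeasure_real measurableSet_Iio, fejerMeasure_real measurableSet_Iic,
    ← intervalIntegral_fejerKernel, ← h, integral_Iic_eq_integral_Iio,
    integral_Iic_eq_integral_Iio]
  ring

theorem integral_measureReal_Iio_fejerMeasure (μ : Measure ℝ) [IsProbabilityMeasure μ] {T : ℝ}
    (hT : 0 < T) (y : ℝ) :
    ∫ u, μ.real (Set.Iio (y - u / T)) ∂fejerMeasure =
      ∫ s, fejerMeasure.real (Set.Iio (T * (y - s))) ∂μ := by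
  set A : Set (ℝ × ℝ) := {p | p.2 < y - p.1 / T} with hA
  have hAm : MeasurableSet A := measurableSet_lt (by fun_prop) (by fun_prop)
  have hI : Integrable (Function.uncurry fun u s : ℝ => A.indicator (1 : ℝ × ℝ → ℝ) (u, s))
      (fejerMeasure.prod μ) := (integrable_const (1 : ℝ)).indicator hAm
  have h := integral_integral_swap hI
  have h1 : ∀ u, ∫ s, A.indicator (1 : ℝ × ℝ → ℝ) (u, s) ∂μ = μ.real (Set.Iio (y - u / T)) := by
    intro u
    rw [← integral_indicator_one measurableSet_Iio]
    rfl
  have h2 : ∀ s, ∫ u, A.indicator (1 : ℝ × ℝ → ℝ) (u, s) ∂fejerMeasure =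
      fejerMeasure.real (Set.Iio (T * (y - s))) := by
    intro s
    rw [← integral_indicator_one measurableSet_Iio]
    congr 1
    ext u
    have : (u, s) ∈ A ↔ u ∈ Set.Iio (T * (y - s)) := by
      simp only [hA, Set.mem_ofPred_eq, Set.mem_Iio]
      rw [lt_sub_comm, div_lt_iff₀ hT, mul_comm]
    simp only [Set.indicator, this, Pi.one_apply]
  simpa only [h1, h2] using h

/-- The first moment of `μ` is what justifies Fubini here: near `t = 0` the integrand is controlled
only by `|T (y - s)|`. The additive constant does not depend on `μ`, so it cancels when two laws are
compared. -/
theorem integral_measureReal_Iio_fejerMeasure_eq (μ : Measure ℝ) [IsProbabilityMeasure μ]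
    (hμ : Integrable id μ) {T : ℝ} (hT : 0 < T) (y : ℝ) :
    ∫ u, μ.real (Set.Iio (y - u / T)) ∂fejerMeasure = fejerMeasure.real (Set.Iic 0) +
      (∫ t in (0 : ℝ)..1, (1 - t) * ∫ s, T * (y - s) * Real.sinc (t * (T * (y - s))) ∂μ)
        / ∫ u, fejerKernel u := by
  have hint : Integrable (fun s => T * (y - s)) μ := ((integrable_const y).sub hμ).const_mul T
  have : IsFiniteMeasure (volume.restrict (Set.uIoc (0 : ℝ) 1)) := by
    rw [Set.uIoc_of_le zero_le_one]; infer_instance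
  have hI : Integrable (Function.uncurry fun t s : ℝ =>
      (1 - t) * (T * (y - s) * Real.sinc (t * (T * (y - s)))))
      ((volume.restrict (Set.uIoc (0 : ℝ) 1)).prod μ) := by
    have h1 : Integrable (fun p : ℝ × ℝ => T * (y - p.2))
        ((volume.restrict (Set.uIoc (0 : ℝ) 1)).prod μ) := hint.comp_snd _
    refine h1.norm.mono' ?_ ?_
    · refine Measurable.aestronglyMeasurable ?_
      have := Real.measurable_sinc
      unfold Function.uncurry
      fun_prop
    · have : ∀ᵐ p ∂((volume.restrict (Set.uIoc (0 : ℝ) 1)).prod μ), p.1 ∈ Set.uIoc (0 : ℝ) 1 :=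
        Measure.quasiMeasurePreserving_fst.ae (ae_restrict_mem measurableSet_uIoc)
      filter_upwards [this] with p hp
      rw [Set.uIoc_of_le zero_le_one] at hp
      simp only [Function.uncurry, norm_mul, Real.norm_eq_abs]
      have h3 := Real.abs_sinc_le_one (p.1 * (T * (y - p.2)))
      have h4 : |1 - p.1| ≤ 1 := abs_le.2 ⟨by linarith [hp.2], by linarith [hp.1]⟩
      calc |1 - p.1| * (|T| * |y - p.2| * |Real.sinc (p.1 * (T * (y - p.2)))|)
          ≤ 1 * (|T| * |y - p.2| * 1) := by gcongr
        _ = |T| * |y - p.2| := by ring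
  have h2 := intervalIntegral_integral_swap hI
  have hI2 : Integrable (fun s => ∫ t in (0 : ℝ)..1,
      (1 - t) * (T * (y - s) * Real.sinc (t * (T * (y - s))))) μ := by
    simp only [intervalIntegral.integral_of_le zero_le_one]
    rw [Set.uIoc_of_le zero_le_one] at hI
    exact hI.integral_prod_right
  simp only [integral_const_mul] at h2
  rw [integral_measureReal_Iio_fejerMeasure μ hT, h2]
  simp only [fejerMeasure_real_Iio]
  rw [integral_add (integrable_const _) (hI2.div_const _), integral_div]
  simp

theorem abs_integral_sinc_sub_le (μ ν : Measure ℝ) [IsProbabilityMeasure μ]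
    [IsProbabilityMeasure ν] (y : ℝ) {T t : ℝ} (ht : 0 < t) (hT : 0 < T) :
    |(∫ s, T * (y - s) * Real.sinc (t * (T * (y - s))) ∂μ)
        - ∫ s, T * (y - s) * Real.sinc (t * (T * (y - s))) ∂ν|
      ≤ ‖charFun μ (t * T) - charFun ν (t * T)‖ / t := by
  -- The integrand is `sin(tT(y - s))/t`, the imaginary part of `e^{itTy} e^{-itTs}` divided by `t`.
  have key : ∀ (ρ : Measure ℝ) [IsProbabilityMeasure ρ],
      (∫ s, T * (y - s) * Real.sinc (t * (T * (y - s))) ∂ρ) =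
        (Complex.exp ((t * T * y : ℝ) * Complex.I) * charFun ρ (-(t * T))).im / t := by
    intro ρ _
    rw [charFun_apply_real, ← integral_const_mul]
    have hi : Integrable (fun x : ℝ => Complex.exp ((t * T * y : ℝ) * Complex.I) *
        Complex.exp ((-(t * T) : ℝ) * x * Complex.I)) ρ := by
      refine (integrable_const (1 : ℝ)).mono' (by fun_prop) (ae_of_all _ fun x => ?_)
      rw [norm_mul, Complex.norm_exp_ofReal_mul_I, ← Complex.ofReal_mul,
        Complex.norm_exp_ofReal_mul_I, mul_one]
    rw [← Complex.imCLM_apply, ← ContinuousLinearMap.integral_comp_comm _ hi, ← integral_div]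
    congr 1
    ext s
    rw [Complex.imCLM_apply, ← Complex.exp_add, ← Complex.ofReal_mul, ← add_mul,
      ← Complex.ofReal_add, Complex.exp_ofReal_mul_I_im]
    rcases eq_or_ne (y - s) 0 with h | h
    · have : t * T * y + -(t * T) * s = 0 := by
        rw [show t * T * y + -(t * T) * s = t * T * (y - s) by ring, h, mul_zero]
      rw [h, this]; simp
    · rw [Real.sinc_of_ne_zero (by positivity)]
      rw [show t * T * y + -(t * T) * s = t * (T * (y - s)) by ring]
      field_simp
  rw [key, key, ← sub_div, abs_div, abs_of_pos ht, ← Complex.sub_im, ← mul_sub, charFun_neg,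
    charFun_neg, ← map_sub]
  gcongr
  refine (Complex.abs_im_le_norm _).trans ?_
  rw [norm_mul, Complex.norm_exp_ofReal_mul_I, one_mul, RCLike.norm_conj]

theorem abs_integral_fejerMeasure_sub_le (μ ν : Measure ℝ) [IsProbabilityMeasure μ]
    [IsProbabilityMeasure ν] (hμ : Integrable id μ) (hν : Integrable id ν) {T : ℝ} (hT : 0 < T)
    {g : ℝ → ℝ} (hg0 : ∀ t, 0 ≤ g t) (hg : IntegrableOn g (Set.Ioi 0))
    (h : ∀ t, 0 < t → t ≤ T → ‖charFun μ t - charFun ν t‖ ≤ t * g t) (y : ℝ) :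
    |∫ u, (μ.real (Set.Iio (y - u / T)) - ν.real (Set.Iio (y - u / T))) ∂fejerMeasure| ≤
      (∫ t in Set.Ioi 0, g t) / ∫ u, fejerKernel u := by
  have hm : ∀ (ρ : Measure ℝ) [IsProbabilityMeasure ρ],
      Integrable (fun u => ρ.real (Set.Iio (y - u / T))) fejerMeasure := by
    intro ρ _
    refine (integrable_const (1 : ℝ)).mono' ?_ (ae_of_all _ fun u => ?_)
    · refine (Antitone.measurable ?_).aestronglyMeasurable
      intro a b hab
      refine measureReal_mono (Set.Iio_subset_Iio ?_)
      gcongr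
    · rw [Real.norm_of_nonneg measureReal_nonneg]
      exact measureReal_le_one
  have hsub : Set.Ioc 0 T ⊆ Set.Ioi 0 := Set.Ioc_subset_Ioi_self
  have hgT : IntervalIntegrable g volume 0 T :=
    (intervalIntegrable_iff_integrableOn_Ioc_of_le hT.le).2 (hg.mono_set hsub)
  have hcont : ∀ (ρ : Measure ℝ) [IsProbabilityMeasure ρ], Integrable id ρ →
      IntervalIntegrable (fun t => (1 - t) *
        ∫ s, T * (y - s) * Real.sinc (t * (T * (y - s))) ∂ρ) volume 0 1 := by
    intro ρ _ hρ
    apply Continuous.intervalIntegrable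
    refine (by fun_prop : Continuous fun t : ℝ => 1 - t).mul ?_
    refine continuous_of_dominated (bound := fun s => ‖T * (y - s)‖) ?_ ?_ ?_ ?_
    · intro t
      have := Real.measurable_sinc
      exact (by fun_prop : Measurable _).aestronglyMeasurable
    · intro t
      refine ae_of_all _ fun s => ?_
      rw [norm_mul]
      exact mul_le_of_le_one_right (norm_nonneg _) (Real.abs_sinc_le_one _)
    · exact (((integrable_const y).sub hρ).const_mul T).norm
    · have := Real.continuous_sinc
      exact ae_of_all _ fun s => by fun_prop
  rw [integral_sub (hm μ) (hm ν), integral_measureReal_Iio_fejerMeasure_eq μ hμ hT,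
    integral_measureReal_Iio_fejerMeasure_eq ν hν hT, add_sub_add_left_eq_sub, ← sub_div,
    abs_div, abs_of_pos integral_fejerKernel_pos,
    ← intervalIntegral.integral_sub (hcont μ hμ) (hcont ν hν)]
  refine div_le_div_of_nonneg_right ?_ integral_fejerKernel_pos.le
  have hgT' : IntervalIntegrable (fun t => T * g (T * t)) volume 0 1 := by
    have := (hgT.comp_mul_left (c := T)).const_mul T
    simpa [hT.ne'] using this
  calc _ ≤ ∫ t in (0 : ℝ)..1, T * g (T * t) := by
        rw [← Real.norm_eq_abs]
        refine intervalIntegral.norm_integral_le_of_norm_le zero_le_one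
          (ae_of_all _ fun t ht => ?_) hgT'
        rw [← mul_sub, norm_mul, Real.norm_eq_abs, Real.norm_eq_abs]
        have h1 := abs_integral_sinc_sub_le μ ν y ht.1 hT
        have h2 := h (t * T) (mul_pos ht.1 hT) (by nlinarith [ht.2])
        have h4 : |1 - t| ≤ 1 := abs_le.2 ⟨by linarith [ht.2], by linarith [ht.1]⟩
        calc _ ≤ 1 * (t * T * g (t * T) / t) := by
              gcongr
              exact h1.trans (div_le_div_of_nonneg_right h2 ht.1.le)
          _ = T * g (T * t) := by
              have := ht.1.ne'
              rw [mul_comm t T]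
              field_simp
    _ = ∫ t in (0 : ℝ)..T, g t := by
        rw [intervalIntegral.integral_const_mul, intervalIntegral.integral_comp_mul_left _ hT.ne']
        simp [hT.ne']
    _ ≤ ∫ t in Set.Ioi 0, g t := by
        rw [intervalIntegral.integral_of_le hT.le]
        exact setIntegral_mono_set hg (ae_of_all _ hg0) hsub.eventuallyLE

theorem exists_measureReal_compl_Icc_le (κ : Measure ℝ) [IsFiniteMeasure κ] {ε : ℝ} (hε : 0 < ε) :
    ∃ a : ℝ, 0 < a ∧ κ.real (Set.Icc (-a) a)ᶜ ≤ ε := by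
  have h : Tendsto (fun n : ℕ => κ.real (Set.Icc (-(n : ℝ)) n)ᶜ) atTop (𝓝 (κ.real ∅)) := by
    have hempty : ⋂ n : ℕ, (Set.Icc (-(n : ℝ)) n)ᶜ = ∅ := by
      rw [← Set.compl_iUnion, Set.compl_empty_iff]
      refine Set.eq_univ_of_forall fun x => Set.mem_iUnion.2 ?_
      obtain ⟨n, hn⟩ := exists_nat_ge |x|
      exact ⟨n, abs_le.1 hn⟩
    rw [← hempty]
    simp only [measureReal_def]
    refine (ENNReal.tendsto_toReal (measure_ne_top _ _)).comp
      (tendsto_measure_iInter_atTop (fun n => measurableSet_Icc.compl.nullMeasurableSet) ?_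
        ⟨0, measure_ne_top _ _⟩)
    intro m n hmn
    have : (m : ℝ) ≤ n := by exact_mod_cast hmn
    exact Set.compl_subset_compl.2 (Set.Icc_subset_Icc (by linarith) this)
  rw [measureReal_empty] at h
  obtain ⟨n, hn, hn0⟩ := ((h.eventually_le_const hε).and (eventually_gt_atTop 0)).exists
  exact ⟨n, by exact_mod_cast hn0, hn⟩

/-- The kernel has tails of order `v⁻²`, hence no first moment, so it is truncated to `[-a, a]`.
There one-sided Lipschitz control keeps `δ` near `δ y`; outside, `δ ≥ -D` is used. With outer mass
`p ≤ 1/4` the loss is at most `2pD ≤ D/2`, which can be absorbed once `D` is the supremum. -/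
theorem le_of_smoothing {κ : Measure ℝ} [IsProbabilityMeasure κ] {a : ℝ} (ha : 0 < a)
    (hκ : κ.real (Set.Icc (-a) a)ᶜ ≤ 1 / 4) {δ : ℝ → ℝ} (hδ : Measurable δ) {l T J D : ℝ}
    (hl : 0 ≤ l) (hT : 0 < T) (hD : ∀ y, |δ y| ≤ D)
    (hmono : ∀ y s, 0 ≤ s → δ y - l * s ≤ δ (y + s))
    (hJ : ∀ y, ∫ u, δ (y - u / T) ∂κ ≤ J) (y : ℝ) :
    δ y ≤ D / 2 + (J + 2 * (a * (l / T))) := by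
  set A := Set.Icc (-a) a with hA
  have hAm : MeasurableSet A := measurableSet_Icc
  set b := δ y - 2 * (a * (l / T)) with hb
  have hD0 : 0 ≤ D := (abs_nonneg _).trans (hD 0)
  -- The smoothed function is evaluated at `y + a/T` so that every displacement `(a - u)/T` with `u`
  -- in `[-a, a]` is nonnegative, as the one-sided hypothesis requires.
  have hi : Integrable (fun u => δ (y + a / T - u / T)) κ := by
    refine (integrable_const D).mono' ?_ (ae_of_all _ fun u => hD _)
    exact (hδ.comp (by fun_prop)).aestronglyMeasurable
  have h1 : κ.real A * b ≤ ∫ u in A, δ (y + a / T - u / T) ∂κ := by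
    rw [← smul_eq_mul, ← setIntegral_const]
    refine setIntegral_mono_on (integrable_const _).integrableOn hi.integrableOn hAm
      fun u hu => ?_
    have h2 := hmono y ((a - u) / T) (div_nonneg (by linarith [hu.2]) hT.le)
    rw [show y + a / T - u / T = y + (a - u) / T by ring]
    refine le_trans ?_ h2
    have : l * ((a - u) / T) ≤ 2 * (a * (l / T)) := by
      rw [show l * ((a - u) / T) = (l / T) * (a - u) by ring,
        show 2 * (a * (l / T)) = (l / T) * (2 * a) by ring]
      have : 0 ≤ l / T := by positivity
      gcongr
      linarith [hu.1]
    linarith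
  have h2 : κ.real Aᶜ * (-D) ≤ ∫ u in Aᶜ, δ (y + a / T - u / T) ∂κ := by
    rw [← smul_eq_mul, ← setIntegral_const]
    exact setIntegral_mono_on (integrable_const _).integrableOn hi.integrableOn hAm.compl
      fun u _ => (abs_le.1 (hD _)).1
  have h3 := integral_add_compl hAm hi
  have h4 := hJ (y + a / T)
  have h5 : κ.real A = 1 - κ.real Aᶜ := by
    have := probReal_add_probReal_compl (μ := κ) hAm
    linarith
  have h6 : 0 ≤ κ.real Aᶜ := measureReal_nonneg
  have h7 : δ y ≤ D := (abs_le.1 (hD y)).2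
  have h8 : 0 ≤ 2 * (a * (l / T)) := by positivity
  rw [h5] at h1
  nlinarith

theorem abs_le_of_smoothing {κ : Measure ℝ} [IsProbabilityMeasure κ] {a : ℝ} (ha : 0 < a)
    (hκ : κ.real (Set.Icc (-a) a)ᶜ ≤ 1 / 4) {δ : ℝ → ℝ} (hδ : Measurable δ) {l T J : ℝ}
    (hl : 0 ≤ l) (hT : 0 < T) (hD : ∃ D, ∀ y, |δ y| ≤ D)
    (hmono : ∀ y s, 0 ≤ s → δ y - l * s ≤ δ (y + s))
    (hJ : ∀ y, |∫ u, δ (y - u / T) ∂κ| ≤ J) (hJ' : ∀ y, |∫ u, δ (y + u / T) ∂κ| ≤ J) (y : ℝ) :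
    |δ y| ≤ 2 * (J + 2 * (a * (l / T))) := by
  have hbdd : BddAbove (Set.range fun y => |δ y|) := by
    obtain ⟨D, hD⟩ := hD
    exact ⟨D, by rintro _ ⟨y, rfl⟩; exact hD y⟩
  set D := ⨆ y, |δ y| with hDdef
  have hle : ∀ y, |δ y| ≤ D := fun y => le_ciSup hbdd y
  have key : ∀ y, |δ y| ≤ D / 2 + (J + 2 * (a * (l / T))) := by
    intro y
    refine abs_le'.2 ⟨le_of_smoothing ha hκ hδ hl hT hle hmono (fun y => (abs_le.1 (hJ y)).2) y, ?_⟩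
    -- The reflection `δ ↦ -δ(-·)` preserves the one-sided Lipschitz condition and turns the upper
    -- bound into the lower one.
    have := le_of_smoothing (δ := fun y => - δ (-y)) (J := J) (D := D) ha hκ
      (hδ.comp measurable_neg).neg hl hT (fun y => by simpa using hle (-y)) ?_ ?_ (-y)
    · simpa using this
    · intro y s hs
      have := hmono (-(y + s)) s hs
      rw [show -(y + s) + s = -y by ring] at this
      linarith
    · intro y
      rw [integral_neg]
      have := (abs_le.1 (hJ' (-y))).1
      simp only [sub_eq_add_neg, neg_add, neg_neg] at this ⊢
      linarith
  have := ciSup_le key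
  have h2 := hle y
  linarith

theorem fejerKernel_neg (v : ℝ) : fejerKernel (-v) = fejerKernel v := by
  simp [fejerKernel]

theorem integral_comp_neg_fejerMeasure (f : ℝ → ℝ) :
    ∫ u, f (-u) ∂fejerMeasure = ∫ u, f u ∂fejerMeasure := by
  have hm : Measurable fun v => (fejerKernel v / ∫ u, fejerKernel u).toNNReal :=
    (continuous_fejerKernel.measurable.div_const _).real_toNNReal
  have h := fun g : ℝ → ℝ => integral_withDensity_eq_integral_smul (μ := volume) hm g
  have h' : fejerMeasure = volume.withDensity
      fun v => ((fejerKernel v / ∫ u, fejerKernel u).toNNReal : ENNReal) := rfl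
  rw [h', h, h, ← integral_neg_eq_self]
  simp [fejerKernel_neg]

/-- Esseen's smoothing inequality. -/
theorem exists_esseen_smoothing : ∃ C : ℝ, 0 < C ∧ ∀ (μ ν : Measure ℝ) [IsProbabilityMeasure μ]
    [IsProbabilityMeasure ν], Integrable id μ → Integrable id ν → ∀ (l T : ℝ), 0 ≤ l → 0 < T →
    (∀ y s, 0 ≤ s → ν.real (Set.Iio (y + s)) ≤ ν.real (Set.Iio y) + l * s) →
    ∀ g : ℝ → ℝ, (∀ t, 0 ≤ g t) → IntegrableOn g (Set.Ioi 0) →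
    (∀ t, 0 < t → t ≤ T → ‖charFun μ t - charFun ν t‖ ≤ t * g t) →
    ∀ y, |μ.real (Set.Iio y) - ν.real (Set.Iio y)| ≤ C * ((∫ t in Set.Ioi 0, g t) + l / T) := by
  obtain ⟨a, ha, hκ⟩ := exists_measureReal_compl_Icc_le fejerMeasure (ε := 1 / 4) (by norm_num)
  have hc := integral_fejerKernel_pos
  refine ⟨2 * (1 / (∫ u, fejerKernel u)) + 4 * a, by positivity, ?_⟩
  intro μ ν _ _ hμ hν l T hl hT hlip g hg0 hg h y
  have hJ := abs_integral_fejerMeasure_sub_le μ ν hμ hν hT hg0 hg h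
  have hmeas : ∀ (ρ : Measure ℝ) [IsProbabilityMeasure ρ],
      Measurable fun y => ρ.real (Set.Iio y) := fun ρ _ =>
    Monotone.measurable fun a b hab => measureReal_mono (Set.Iio_subset_Iio hab)
  have := abs_le_of_smoothing (δ := fun y => μ.real (Set.Iio y) - ν.real (Set.Iio y)) ha hκ
    ((hmeas μ).sub (hmeas ν)) hl hT ⟨1, fun y => ?_⟩ ?_ hJ ?_ y
  · refine this.trans ?_
    have hg1 : 0 ≤ ∫ t in Set.Ioi 0, g t := integral_nonneg hg0
    have hlT : 0 ≤ l / T := by positivity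
    rw [show 2 * ((∫ t in Set.Ioi 0, g t) / (∫ u, fejerKernel u) + 2 * (a * (l / T))) =
      2 * (1 / (∫ u, fejerKernel u)) * (∫ t in Set.Ioi 0, g t) + 4 * a * (l / T) by ring]
    have h1 : 0 ≤ 2 * (1 / (∫ u, fejerKernel u)) := by positivity
    have h2 : 0 ≤ 4 * a := by positivity
    nlinarith [mul_nonneg h1 hlT, mul_nonneg h2 hg1]
  · have h1 : 0 ≤ μ.real (Set.Iio y) := measureReal_nonneg
    have h2 : 0 ≤ ν.real (Set.Iio y) := measureReal_nonneg
    have h3 : μ.real (Set.Iio y) ≤ 1 := measureReal_le_one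
    have h4 : ν.real (Set.Iio y) ≤ 1 := measureReal_le_one
    exact abs_le.2 ⟨by linarith, by linarith⟩
  · intro y s hs
    have h1 := hlip y s hs
    have h2 : μ.real (Set.Iio y) ≤ μ.real (Set.Iio (y + s)) :=
      measureReal_mono (Set.Iio_subset_Iio (by linarith))
    linarith
  · intro y
    have := hJ y
    rw [← integral_comp_neg_fejerMeasure] at this
    simpa [neg_div] using this

/-! ### From Kolmogorov distance to exponential tail integrals. -/

theorem abs_measureReal_Ico_sub_le (μ ν : Measure ℝ) [IsProbabilityMeasure μ]
    [IsProbabilityMeasure ν] {ε : ℝ}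
    (h : ∀ y, |μ.real (Set.Iio y) - ν.real (Set.Iio y)| ≤ ε) {a b : ℝ} (hab : a ≤ b) :
    |μ.real (Set.Ico a b) - ν.real (Set.Ico a b)| ≤ 2 * ε := by
  have key : ∀ (ρ : Measure ℝ) [IsProbabilityMeasure ρ],
      ρ.real (Set.Ico a b) = ρ.real (Set.Iio b) - ρ.real (Set.Iio a) := by
    intro ρ _
    rw [← measureReal_sdiff (Set.Iio_subset_Iio hab) measurableSet_Iio]
    congr 1
    ext y
    simp
  rw [key, key]
  have ha := abs_le.1 (h a)
  have hb := abs_le.1 (h b)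
  exact abs_le.2 ⟨by linarith [ha.2, hb.1], by linarith [ha.1, hb.2]⟩

theorem abs_measureReal_Ici_sub_le (μ ν : Measure ℝ) [IsProbabilityMeasure μ]
    [IsProbabilityMeasure ν] {ε : ℝ}
    (h : ∀ y, |μ.real (Set.Iio y) - ν.real (Set.Iio y)| ≤ ε) (a : ℝ) :
    |μ.real (Set.Ici a) - ν.real (Set.Ici a)| ≤ 2 * ε := by
  have key : ∀ (ρ : Measure ℝ) [IsProbabilityMeasure ρ],
      ρ.real (Set.Ici a) = 1 - ρ.real (Set.Iio a) := by
    intro ρ _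
    rw [← Set.compl_Iio, probReal_compl_eq_one_sub measurableSet_Iio]
  rw [key, key]
  have ha := abs_le.1 (h a)
  have hε : 0 ≤ ε := (abs_nonneg _).trans (h a)
  exact abs_le.2 ⟨by linarith [ha.2], by linarith [ha.1]⟩

/-- The function `y ↦ e^{-x (y - a)}` on `[a, ∞)`, extended by zero. -/
noncomputable def expTail (x a y : ℝ) : ℝ :=
  (Set.Ici a).indicator (fun y => Real.exp (-(x * (y - a)))) y

theorem expTail_nonneg (x a y : ℝ) : 0 ≤ expTail x a y :=
  Set.indicator_nonneg (fun _ _ => (Real.exp_pos _).le) y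

theorem expTail_le_one {x : ℝ} (hx : 0 ≤ x) (a y : ℝ) : expTail x a y ≤ 1 := by
  refine Set.indicator_le' (g := fun _ => 1) (fun y hy => ?_) (fun _ _ => zero_le_one) y
  rw [Real.exp_le_one_iff, neg_nonpos]
  exact mul_nonneg hx (sub_nonneg.2 hy)

theorem measurable_expTail (x a : ℝ) : Measurable (expTail x a) :=
  Measurable.indicator (by fun_prop) measurableSet_Ici

theorem integrable_expTail (μ : Measure ℝ) [IsFiniteMeasure μ] {x : ℝ} (hx : 0 ≤ x) (a : ℝ) :
    Integrable (expTail x a) μ := by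
  refine (integrable_const (1 : ℝ)).mono' (measurable_expTail x a).aestronglyMeasurable
    (ae_of_all _ fun y => ?_)
  rw [Real.norm_of_nonneg (expTail_nonneg x a y)]
  exact expTail_le_one hx a y

theorem setOf_lt_expTail {x t : ℝ} (hx : 0 < x) (a : ℝ) (ht : 0 < t) :
    {y | t < expTail x a y} = Set.Ico a (a - Real.log t / x) := by
  ext y
  simp only [expTail, Set.indicator, Set.mem_Ici, Set.mem_ofPred_eq, Set.mem_Ico]
  by_cases hy : a ≤ y
  · simp only [hy, if_true, true_and]
    rw [← Real.log_lt_iff_lt_exp ht, lt_sub_comm, div_lt_iff₀ hx]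
    constructor <;> intro h <;> linarith
  · simp [hy, ht.le]

theorem setOf_lt_expTail_zero {t : ℝ} (a : ℝ) (ht : 0 < t) (ht1 : t < 1) :
    {y | t < expTail 0 a y} = Set.Ici a := by
  ext y
  simp only [expTail, Set.indicator, Set.mem_Ici, Set.mem_ofPred_eq]
  by_cases hy : a ≤ y <;> simp [hy, ht.le, ht1]

/-- Layer cake replaces integration by parts: each superlevel set of `expTail` at a level in `(0,
1)` is an interval, whose two measures differ by at most `2ε`. The bound is therefore uniform in
`x`, including `x = 0`, where the intervals become half-lines. -/
theorem abs_integral_expTail_sub_le (μ ν : Measure ℝ) [IsProbabilityMeasure μ]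
    [IsProbabilityMeasure ν] {ε : ℝ}
    (h : ∀ y, |μ.real (Set.Iio y) - ν.real (Set.Iio y)| ≤ ε) {x : ℝ} (hx : 0 ≤ x) (a : ℝ) :
    |∫ y, expTail x a y ∂μ - ∫ y, expTail x a y ∂ν| ≤ 2 * ε := by
  have key : ∀ (ρ : Measure ℝ) [IsProbabilityMeasure ρ],
      ∫ y, expTail x a y ∂ρ = ∫ t in Set.Ioo (0 : ℝ) 1, ρ.real {y | t < expTail x a y} := by
    intro ρ _
    rw [(integrable_expTail ρ hx a).integral_eq_integral_meas_lt
      (ae_of_all _ (expTail_nonneg x a))]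
    refine setIntegral_eq_of_subset_of_forall_sdiff_eq_zero measurableSet_Ioi
      Set.Ioo_subset_Ioi_self fun t ht => ?_
    have h1 : 1 ≤ t := not_lt.1 fun h => ht.2 ⟨ht.1, h⟩
    have : {y | t < expTail x a y} = ∅ :=
      Set.eq_empty_of_forall_notMem fun y hy =>
        absurd (expTail_le_one hx a y) (not_le.2 (h1.trans_lt hy))
    rw [this, measureReal_empty]
  have hint : ∀ (ρ : Measure ℝ) [IsProbabilityMeasure ρ],
      IntegrableOn (fun t => ρ.real {y | t < expTail x a y}) (Set.Ioo (0 : ℝ) 1) := by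
    intro ρ _
    refine (integrable_const (1 : ℝ)).mono' (Antitone.measurable ?_).aestronglyMeasurable
      (ae_of_all _ fun u => ?_)
    · intro s t hst
      exact measureReal_mono fun y hy => lt_of_le_of_lt hst hy
    · rw [Real.norm_of_nonneg measureReal_nonneg]
      exact measureReal_le_one
  rw [key μ, key ν, ← integral_sub (hint μ) (hint ν), ← Real.norm_eq_abs]
  refine (norm_setIntegral_le_of_norm_le_const (C := 2 * ε) (by simp) fun t ht => ?_).trans
    (by simp)
  rw [Real.norm_eq_abs]
  rcases hx.eq_or_lt with rfl | hx
  · rw [setOf_lt_expTail_zero a ht.1 ht.2]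
    exact abs_measureReal_Ici_sub_le μ ν h a
  · rw [setOf_lt_expTail hx a ht.1]
    refine abs_measureReal_Ico_sub_le μ ν h ?_
    have : Real.log t / x ≤ 0 := div_nonpos_of_nonpos_of_nonneg (Real.log_nonpos ht.1.le ht.2.le) hx.le
    linarith

/-! ### Gaussian laws and their half-line Laplace transforms. -/

theorem gaussianPDFReal_le_one (m : ℝ) {v : NNReal} (hv : 1 / 2 ≤ v) (y : ℝ) :
    gaussianPDFReal m v y ≤ 1 := by
  have hv' : (1 / 2 : ℝ) ≤ v := by exact_mod_cast hv
  have h1 : 1 ≤ √(2 * Real.pi * v) := by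
    rw [Real.one_le_sqrt]
    nlinarith [Real.pi_gt_three]
  rw [gaussianPDFReal]
  have h2 : Real.exp (-(y - m) ^ 2 / (2 * v)) ≤ 1 := by
    rw [Real.exp_le_one_iff]
    exact div_nonpos_of_nonpos_of_nonneg (by nlinarith [sq_nonneg (y - m)]) (by positivity)
  calc _ ≤ 1 * (1 : ℝ) := by
        gcongr
        exact inv_le_one_of_one_le₀ h1
    _ = 1 := one_mul 1

theorem gaussianReal_real_Iio_add_le (m : ℝ) {v : NNReal} (hv : 1 / 2 ≤ v) (y s : ℝ)
    (hs : 0 ≤ s) :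
    (gaussianReal m v).real (Set.Iio (y + s)) ≤ (gaussianReal m v).real (Set.Iio y) + 1 * s := by
  have hv0 : v ≠ 0 := by
    rintro rfl
    exact absurd hv (by norm_num)
  have h1 : Set.Iio (y + s) ⊆ Set.Iio y ∪ Set.Ico y (y + s) := by
    intro u hu
    rcases lt_or_ge u y with h | h
    · exact Or.inl h
    · exact Or.inr ⟨h, hu⟩
  have h2 : (gaussianReal m v).real (Set.Ico y (y + s)) ≤ 1 * s := by
    rw [measureReal_def, gaussianReal_apply_eq_integral m hv0, ENNReal.toReal_ofReal
      (setIntegral_nonneg measurableSet_Ico fun u _ => gaussianPDFReal_nonneg m v u)]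
    calc _ ≤ ∫ u in Set.Ico y (y + s), (1 : ℝ) :=
          setIntegral_mono_on (integrable_gaussianPDFReal m v).integrableOn
            (by simp) measurableSet_Ico fun u _ => gaussianPDFReal_le_one m hv u
      _ = 1 * s := by simp [hs]
  exact (measureReal_mono h1).trans ((measureReal_union_le _ _).trans (by linarith))

/-- The Laplace transform at `x` of the restriction to `(0, ∞)` of a Gaussian law. -/
noncomputable def gaussianHalfLaplace (m : ℝ) (v : NNReal) (x : ℝ) : ℝ :=
  ∫ w in Set.Ioi (0 : ℝ), Real.exp (-(x * w)) * gaussianPDFReal m v w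

theorem integrableOn_exp_mul_gaussianPDFReal (m : ℝ) (v : NNReal) {x : ℝ} (hx : 0 ≤ x) :
    IntegrableOn (fun w => Real.exp (-(x * w)) * gaussianPDFReal m v w) (Set.Ioi 0) := by
  refine (integrable_gaussianPDFReal m v).integrableOn.mono' (by fun_prop) ?_
  filter_upwards [ae_restrict_mem measurableSet_Ioi] with w hw
  rw [norm_mul, Real.norm_of_nonneg (Real.exp_pos _).le,
    Real.norm_of_nonneg (gaussianPDFReal_nonneg _ _ _)]
  refine mul_le_of_le_one_left (gaussianPDFReal_nonneg _ _ _) ?_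
  rw [Real.exp_le_one_iff, neg_nonpos]
  exact mul_nonneg hx (le_of_lt hw)

theorem integral_expTail_gaussianReal (m a x : ℝ) {v : NNReal} (hv : v ≠ 0) :
    ∫ y, expTail x a y ∂(gaussianReal m v) = gaussianHalfLaplace (m - a) v x := by
  rw [integral_gaussianReal_eq_integral_smul hv, gaussianHalfLaplace,
    ← integral_add_right_eq_self _ a, ← integral_indicator measurableSet_Ioi]
  refine integral_congr_ae ?_
  have : ∀ᵐ w : ℝ, w ≠ 0 := by simp [ae_iff]
  filter_upwards [this] with w hw
  simp only [expTail, Set.indicator, Set.mem_Ici, Set.mem_Ioi, le_add_iff_nonneg_left,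
    hw.symm.le_iff_lt, smul_eq_mul, gaussianPDFReal_add, add_sub_cancel_right]
  split_ifs
  · ring
  · simp

/-- Shift by `x` and expand the square: `(w + x)²/2 = x²/2 + xw + w²/2`. This makes
`gaussianHalfLaplace 0 1` the Mills ratio. -/
theorem one_sub_stdNormalDF (x : ℝ) :
    1 - stdNormalDF x = Real.exp (-x ^ 2 / 2) * gaussianHalfLaplace 0 1 x := by
  have h1 : 1 - stdNormalDF x = (gaussianReal 0 1).real (Set.Ioi x) := by
    rw [stdNormalDF, cdf_eq_real, ← Set.compl_Iic, probReal_compl_eq_one_sub measurableSet_Iic]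
  have h2 : Set.Ioi (0 : ℝ) = (fun w => w + x) ⁻¹' Set.Ioi x := by
    ext w; simp
  rw [h1, measureReal_def, gaussianReal_apply_eq_integral 0 one_ne_zero, ENNReal.toReal_ofReal
    (setIntegral_nonneg measurableSet_Ioi fun u _ => gaussianPDFReal_nonneg 0 1 u),
    gaussianHalfLaplace, ← integral_const_mul, h2,
    ← (measurePreserving_add_right volume x).setIntegral_preimage_emb
      (measurableEmbedding_addRight x)]
  congr 1
  ext w
  simp only [gaussianPDFReal]
  rw [mul_left_comm (Real.exp (-(x * w))), mul_left_comm, ← Real.exp_add, ← Real.exp_add]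
  congr 2
  push_cast
  ring

theorem gaussianHalfLaplace_nonneg (m : ℝ) (v : NNReal) (x : ℝ) :
    0 ≤ gaussianHalfLaplace m v x :=
  setIntegral_nonneg measurableSet_Ioi fun w _ =>
    mul_nonneg (Real.exp_pos _).le (gaussianPDFReal_nonneg m v w)

theorem integrableOn_exp_neg_mul {x : ℝ} (hx : 0 < x) :
    IntegrableOn (fun w => Real.exp (-(x * w))) (Set.Ioi 0) := by
  simpa [neg_mul] using integrableOn_exp_mul_Ioi (neg_lt_zero.2 hx) 0

theorem setIntegral_exp_neg_mul {x : ℝ} (hx : 0 < x) :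
    ∫ w in Set.Ioi (0 : ℝ), Real.exp (-(x * w)) = 1 / x := by
  have := integral_exp_mul_Ioi (neg_lt_zero.2 hx) 0
  simpa [neg_mul] using this

theorem mul_gaussianHalfLaplace_le_one {x : ℝ} (hx : 0 ≤ x) :
    x * gaussianHalfLaplace 0 1 x ≤ 1 := by
  rcases hx.eq_or_lt with rfl | hx
  · simp
  · have : gaussianHalfLaplace 0 1 x ≤ 1 / x := by
      rw [← setIntegral_exp_neg_mul hx]
      refine setIntegral_mono_on (integrableOn_exp_mul_gaussianPDFReal 0 1 hx.le)
        (integrableOn_exp_neg_mul hx) measurableSet_Ioi fun w _ => ?_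
      refine mul_le_of_le_one_right (Real.exp_pos _).le (gaussianPDFReal_le_one 0 ?_ w)
      rw [div_le_iff₀ two_pos]; norm_num
    calc x * gaussianHalfLaplace 0 1 x ≤ x * (1 / x) := by gcongr
      _ = 1 := by field_simp

theorem abs_exp_sub_exp_le (a b c : ℝ) (ha : a ≤ c) (hb : b ≤ c) :
    |Real.exp a - Real.exp b| ≤ |a - b| * Real.exp c := by
  wlog h : b ≤ a generalizing a b
  · rw [abs_sub_comm, abs_sub_comm a]
    exact this b a hb ha (le_of_not_ge h)
  rw [abs_of_nonneg (sub_nonneg.2 (Real.exp_le_exp.2 h)), abs_of_nonneg (sub_nonneg.2 h)]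
  have h1 : Real.exp a - Real.exp b = Real.exp a * (1 - Real.exp (b - a)) := by
    rw [mul_sub, mul_one, ← Real.exp_add]; ring_nf
  have h2 : 1 - Real.exp (b - a) ≤ a - b := by linarith [Real.add_one_le_exp (b - a)]
  rw [h1, mul_comm]
  exact mul_le_mul h2 (Real.exp_le_exp.2 ha) (Real.exp_pos _).le (sub_nonneg.2 h)

/-- Both densities are exponentials with exponent at most `1 - w²/6`, so their difference is the
difference of exponents times a Gaussian factor, which absorbs `w²`. The term `|m| w` is left linear
in `w` on purpose: integrated against `e^{-xw}` it gains a further factor `1/x`. -/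
theorem abs_gaussianPDFReal_sub_le {m : ℝ} {v : NNReal} (hm : |m| ≤ 1 / 2)
    (hv : |(v : ℝ) - 1| ≤ 1 / 2) {w : ℝ} (hw : 0 ≤ w) :
    |gaussianPDFReal m v w - gaussianPDFReal 0 1 w| ≤
      3 * (2 * |m| * w + (m ^ 2 + 6 * |(v : ℝ) - 1|)) := by
  obtain ⟨hv1, hv2⟩ := abs_le.1 hv
  obtain ⟨hm1, hm2⟩ := abs_le.1 hm
  have hv0 : 0 < (v : ℝ) := by linarith
  have hpi : 1 ≤ √(2 * Real.pi) := by
    rw [Real.one_le_sqrt]; linarith [Real.pi_gt_three]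
  set E1 := -(w - m) ^ 2 / (2 * v) - Real.log v / 2 with hE1
  set E0 := -w ^ 2 / 2 with hE0
  have h1 : gaussianPDFReal m v w = (√(2 * Real.pi))⁻¹ * Real.exp E1 := by
    rw [gaussianPDFReal, Real.sqrt_mul (by positivity), hE1, Real.exp_sub, mul_inv,
      Real.exp_half, Real.exp_log hv0]
    ring
  have h0 : gaussianPDFReal 0 1 w = (√(2 * Real.pi))⁻¹ * Real.exp E0 := by
    rw [gaussianPDFReal]; simp [hE0]
  have hl1 : Real.log v ≤ v - 1 := Real.log_le_sub_one_of_pos hv0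
  have hl2 : 1 - (v : ℝ)⁻¹ ≤ Real.log v := Real.one_sub_inv_le_log_of_pos hv0
  have hl3 : |Real.log v| ≤ 2 * |(v : ℝ) - 1| := by
    have : -(2 * |(v : ℝ) - 1|) ≤ 1 - (v : ℝ)⁻¹ := by
      rw [show 1 - (v : ℝ)⁻¹ = (v - 1) / v by field_simp, le_div_iff₀ hv0]
      nlinarith [neg_abs_le ((v : ℝ) - 1), abs_nonneg ((v : ℝ) - 1)]
    exact abs_le.2 ⟨by linarith, by linarith [le_abs_self ((v : ℝ) - 1), abs_nonneg ((v : ℝ) - 1)]⟩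
  have hc1 : E1 ≤ -(w ^ 2 / 6) + 1 := by
    have : -(w - m) ^ 2 / (2 * v) ≤ -(w - m) ^ 2 / 3 := by
      rw [neg_div, neg_div]
      refine neg_le_neg ?_
      gcongr
      linarith
    have h5 : -Real.log v / 2 ≤ 1 / 2 := by
      have := (abs_le.1 hl3).1
      linarith
    nlinarith [sq_nonneg (w - 2 * m), abs_nonneg m]
  have hc0 : E0 ≤ -(w ^ 2 / 6) + 1 := by
    rw [hE0]; nlinarith [sq_nonneg w]
  have hd : |E1 - E0| ≤ 2 * |m| * w + (m ^ 2 + |(v : ℝ) - 1| * (1 + w ^ 2)) := by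
    have : E1 - E0 = (2 * m * w - m ^ 2 + (v - 1) * w ^ 2) / (2 * v) - Real.log v / 2 := by
      rw [hE1, hE0]; field_simp; ring
    rw [this]
    have h6 : |(2 * m * w - m ^ 2 + (v - 1) * w ^ 2) / (2 * v)| ≤
        2 * |m| * w + m ^ 2 + |(v : ℝ) - 1| * w ^ 2 := by
      rw [abs_div, abs_of_pos (by linarith : 0 < 2 * (v : ℝ)), div_le_iff₀ (by linarith)]
      have h7 : |2 * m * w - m ^ 2 + (v - 1) * w ^ 2| ≤
          2 * |m| * w + m ^ 2 + |(v : ℝ) - 1| * w ^ 2 := by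
        refine (abs_add_le _ _).trans (add_le_add ((abs_sub _ _).trans (le_of_eq ?_)) (le_of_eq ?_))
        · rw [abs_mul, abs_mul, abs_of_nonneg hw, abs_two, abs_sq]
        · rw [abs_mul, abs_sq]
      have h8 : 0 ≤ 2 * |m| * w + m ^ 2 + |(v : ℝ) - 1| * w ^ 2 := by positivity
      nlinarith
    refine (abs_sub _ _).trans ?_
    rw [abs_div (Real.log v), abs_two]
    linarith
  have hexp : (1 + w ^ 2) * Real.exp (-(w ^ 2 / 6) + 1) ≤ 6 * 3 := by
    rw [Real.exp_add, ← mul_assoc]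
    refine mul_le_mul ?_ Real.exp_one_lt_three.le (Real.exp_pos _).le (by norm_num)
    rw [Real.exp_neg, mul_inv_le_iff₀ (Real.exp_pos _)]
    nlinarith [Real.add_one_le_exp (w ^ 2 / 6)]
  have hexp' : Real.exp (-(w ^ 2 / 6) + 1) ≤ 3 :=
    (Real.exp_le_exp.2 (by nlinarith [sq_nonneg w])).trans Real.exp_one_lt_three.le
  rw [h1, h0, ← mul_sub, abs_mul, abs_of_pos (by positivity)]
  have hmain := abs_exp_sub_exp_le E1 E0 _ hc1 hc0
  calc _ ≤ 1 * |Real.exp E1 - Real.exp E0| := by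
        gcongr
        exact inv_le_one_of_one_le₀ hpi
    _ ≤ (2 * |m| * w + (m ^ 2 + |(v : ℝ) - 1| * (1 + w ^ 2))) *
          Real.exp (-(w ^ 2 / 6) + 1) := by
        rw [one_mul]
        exact hmain.trans (by gcongr)
    _ = (2 * |m| * w + m ^ 2) * Real.exp (-(w ^ 2 / 6) + 1) +
          |(v : ℝ) - 1| * ((1 + w ^ 2) * Real.exp (-(w ^ 2 / 6) + 1)) := by ring
    _ ≤ (2 * |m| * w + m ^ 2) * 3 + |(v : ℝ) - 1| * (6 * 3) := by gcongr
    _ = _ := by ring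

theorem abs_gaussianHalfLaplace_sub_le {m : ℝ} {v : NNReal} (hm : |m| ≤ 1 / 2)
    (hv : |(v : ℝ) - 1| ≤ 1 / 2) {x : ℝ} (hx : 0 < x) :
    |gaussianHalfLaplace m v x - gaussianHalfLaplace 0 1 x| ≤
      6 / x * (4 * |m| / x + (m ^ 2 + 6 * |(v : ℝ) - 1|)) := by
  rw [gaussianHalfLaplace, gaussianHalfLaplace, ← integral_sub
    (integrableOn_exp_mul_gaussianPDFReal m v hx.le)
    (integrableOn_exp_mul_gaussianPDFReal 0 1 hx.le), ← Real.norm_eq_abs]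
  have hx2 : 0 < x / 2 := by positivity
  refine (norm_integral_le_of_norm_le (g := fun w =>
    3 * (4 * |m| / x + (m ^ 2 + 6 * |(v : ℝ) - 1|)) * Real.exp (-(x / 2 * w)))
    ((integrableOn_exp_neg_mul hx2).const_mul _) ?_).trans ?_
  · filter_upwards [ae_restrict_mem measurableSet_Ioi] with w hw
    have hw0 : 0 < w := hw
    rw [← mul_sub, norm_mul, Real.norm_of_nonneg (Real.exp_pos _).le, Real.norm_eq_abs]
    have h1 := abs_gaussianPDFReal_sub_le hm hv hw0.le
    -- One half of the exponential absorbs the factor `w`; the other remains to be integrated.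
    have h2 : Real.exp (-(x * w)) = Real.exp (-(x / 2 * w)) * Real.exp (-(x / 2 * w)) := by
      rw [← Real.exp_add]; ring_nf
    have h3 : w * Real.exp (-(x / 2 * w)) ≤ 2 / x := by
      rw [Real.exp_neg, mul_inv_le_iff₀ (Real.exp_pos _)]
      have := Real.add_one_le_exp (x / 2 * w)
      calc w = 2 / x * (x / 2 * w) := by field_simp
        _ ≤ 2 / x * Real.exp (x / 2 * w) := by gcongr; linarith
    have h4 : Real.exp (-(x / 2 * w)) ≤ 1 := by
      rw [Real.exp_le_one_iff, neg_nonpos]; positivity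
    calc _ ≤ Real.exp (-(x * w)) * (3 * (2 * |m| * w + (m ^ 2 + 6 * |(v : ℝ) - 1|))) := by
          gcongr
      _ = 3 * (2 * |m| * (w * Real.exp (-(x / 2 * w))) +
            (m ^ 2 + 6 * |(v : ℝ) - 1|) * Real.exp (-(x / 2 * w))) *
              Real.exp (-(x / 2 * w)) := by rw [h2]; ring
      _ ≤ 3 * (2 * |m| * (2 / x) + (m ^ 2 + 6 * |(v : ℝ) - 1|) * 1) *
              Real.exp (-(x / 2 * w)) := by gcongr
      _ = _ := by ring
  · rw [integral_const_mul, setIntegral_exp_neg_mul hx2]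
    apply le_of_eq
    field_simp
    ring

/-! ### Cauchy estimates and Taylor remainders. -/

theorem AnalyticOnNhd.hasDerivAt_iteratedDeriv {𝕜 F : Type*} [NontriviallyNormedField 𝕜]
    [NormedAddCommGroup F] [NormedSpace 𝕜 F] [CompleteSpace F] {f : 𝕜 → F} {s : Set 𝕜}
    (hf : AnalyticOnNhd 𝕜 f s) (k : ℕ) {z : 𝕜} (hz : z ∈ s) :
    HasDerivAt (iteratedDeriv k f) (iteratedDeriv (k + 1) f z) z := by
  rw [iteratedDeriv_succ]
  have h := (hf z hz).iterated_deriv k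
  rw [← iteratedDeriv_eq_iterate] at h
  exact h.differentiableAt.hasDerivAt

/-- The mean value inequality on the segment from `a` to `z`. Iterating it raises the order of a
Taylor remainder by one each time; the factorials are given up. -/
theorem norm_sub_le_mul_pow_succ {s : Set ℂ} (hs : Convex ℝ s) {f f' : ℂ → ℂ}
    (hf : ∀ w ∈ s, HasDerivAt f (f' w) w) {a : ℂ} (ha : a ∈ s) {c : ℝ} (hc : 0 ≤ c) {k : ℕ}
    (hf' : ∀ w ∈ s, ‖f' w‖ ≤ c * ‖w - a‖ ^ k) {z : ℂ} (hz : z ∈ s) :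
    ‖f z - f a‖ ≤ c * ‖z - a‖ ^ (k + 1) := by
  have hseg : segment ℝ a z ⊆ s := hs.segment_subset ha hz
  have := (convex_segment a z).norm_image_sub_le_of_norm_hasDerivWithin_le
    (f := f) (f' := f') (C := c * ‖z - a‖ ^ k)
    (fun w hw => (hf w (hseg hw)).hasDerivWithinAt) (fun w hw => ?_)
    (left_mem_segment ℝ a z) (right_mem_segment ℝ a z)
  · rw [pow_succ, ← mul_assoc]; exact this
  · refine (hf' w (hseg hw)).trans ?_
    gcongr
    exact norm_sub_le_of_mem_segment hw

theorem norm_iteratedDeriv_le_of_norm_le {f : ℂ → ℂ} {R M : ℝ} (hR : 0 < R)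
    (hf : AnalyticOnNhd ℂ f (Metric.ball 0 R)) (hM : ∀ z, ‖z‖ < R → ‖f z‖ ≤ M) (k : ℕ) {z : ℂ}
    (hz : ‖z‖ < R / 2) : ‖iteratedDeriv k f z‖ ≤ k.factorial * M / (R / 4) ^ k := by
  have hsub : Metric.closedBall z (R / 4) ⊆ Metric.ball 0 R := by
    intro w hw
    rw [mem_closedBall_iff_norm] at hw
    rw [mem_ball_zero_iff]
    have := norm_le_norm_add_norm_sub' w z
    linarith
  refine Complex.norm_iteratedDeriv_le_of_forall_mem_sphere_norm_le k (by positivity) ?_ ?_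
  · exact (hf.differentiableOn.mono hsub).diffContOnCl_ball subset_rfl
  · intro w hw
    exact hM w (mem_ball_zero_iff.1 (hsub (Metric.sphere_subset_closedBall hw)))

section Taylor

variable {L : ℂ → ℂ} {D A : ℝ}

theorem norm_iteratedDeriv_three_le (hD : 0 < D) (hL : AnalyticOnNhd ℂ L (Metric.ball 0 D))
    (hA : ∀ z, ‖z‖ < D → ‖L z‖ ≤ A * D ^ 2) {z : ℂ} (hz : ‖z‖ < D / 2) :
    ‖iteratedDeriv 3 L z‖ ≤ 384 * A / D := by
  -- Circles of radius `D/4` around points of the half disc give `3! · 4³ = 384`; for the fourth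
  -- derivative the same radius gives `4! · 4⁴ = 6144 = 16 · 384`.
  refine (norm_iteratedDeriv_le_of_norm_le hD hL hA 3 hz).trans (le_of_eq ?_)
  simp [Nat.factorial]
  field_simp
  ring

theorem norm_iteratedDeriv_four_le (hD : 0 < D) (hL : AnalyticOnNhd ℂ L (Metric.ball 0 D))
    (hA : ∀ z, ‖z‖ < D → ‖L z‖ ≤ A * D ^ 2) {z : ℂ} (hz : ‖z‖ < D / 2) :
    ‖iteratedDeriv 4 L z‖ ≤ 6144 * A / D ^ 2 := by
  refine (norm_iteratedDeriv_le_of_norm_le hD hL hA 4 hz).trans (le_of_eq ?_)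
  simp [Nat.factorial]
  field_simp
  ring

theorem norm_iteratedDeriv_two_sub_le (hD : 0 < D) (hL : AnalyticOnNhd ℂ L (Metric.ball 0 D))
    (hA : ∀ z, ‖z‖ < D → ‖L z‖ ≤ A * D ^ 2) (hA0 : 0 ≤ A) {a z : ℂ} (ha : ‖a‖ < D / 2)
    (hz : ‖z‖ < D / 2) :
    ‖iteratedDeriv 2 L z - iteratedDeriv 2 L a‖ ≤ 384 * A / D * ‖z - a‖ := by
  have hsub : Metric.ball (0 : ℂ) (D / 2) ⊆ Metric.ball 0 D :=
    Metric.ball_subset_ball (by linarith)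
  have := norm_sub_le_mul_pow_succ (convex_ball (0 : ℂ) (D / 2)) (k := 0)
    (fun w hw => hL.hasDerivAt_iteratedDeriv 2 (hsub hw)) (mem_ball_zero_iff.2 ha)
    (by positivity : 0 ≤ 384 * A / D) (fun w hw => by
      simpa using norm_iteratedDeriv_three_le hD hL hA (mem_ball_zero_iff.1 hw))
    (mem_ball_zero_iff.2 hz)
  simpa using this

theorem norm_deriv_sub_taylor_le (hD : 0 < D) (hL : AnalyticOnNhd ℂ L (Metric.ball 0 D))
    (hA : ∀ z, ‖z‖ < D → ‖L z‖ ≤ A * D ^ 2) (hA0 : 0 ≤ A) {a z : ℂ} (ha : ‖a‖ < D / 2)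
    (hz : ‖z‖ < D / 2) :
    ‖deriv L z - deriv L a - iteratedDeriv 2 L a * (z - a)‖ ≤ 384 * A / D * ‖z - a‖ ^ 2 := by
  have hsub : Metric.ball (0 : ℂ) (D / 2) ⊆ Metric.ball 0 D :=
    Metric.ball_subset_ball (by linarith)
  have := norm_sub_le_mul_pow_succ (convex_ball (0 : ℂ) (D / 2)) (k := 1)
    (f := fun w => deriv L w - iteratedDeriv 2 L a * (w - a))
    (f' := fun w => iteratedDeriv 2 L w - iteratedDeriv 2 L a) (a := a)
    (fun w hw => ?_) (mem_ball_zero_iff.2 ha)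
    (by positivity : 0 ≤ 384 * A / D) (fun w hw => ?_)
    (mem_ball_zero_iff.2 hz)
  · simpa [sub_right_comm] using this
  · have h := hL.hasDerivAt_iteratedDeriv 1 (hsub hw)
    rw [iteratedDeriv_one] at h
    convert! h.sub (((hasDerivAt_id w).sub_const a).const_mul (iteratedDeriv 2 L a)) using 1
    simp
  · simpa using norm_iteratedDeriv_two_sub_le hD hL hA hA0 ha (mem_ball_zero_iff.1 hw)

theorem norm_sub_taylor_le (hD : 0 < D) (hL : AnalyticOnNhd ℂ L (Metric.ball 0 D))
    (hA : ∀ z, ‖z‖ < D → ‖L z‖ ≤ A * D ^ 2) (hA0 : 0 ≤ A) {a z : ℂ} (ha : ‖a‖ < D / 2)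
    (hz : ‖z‖ < D / 2) :
    ‖L z - L a - deriv L a * (z - a) - iteratedDeriv 2 L a * (z - a) ^ 2 / 2‖ ≤
      384 * A / D * ‖z - a‖ ^ 3 := by
  have hsub : Metric.ball (0 : ℂ) (D / 2) ⊆ Metric.ball 0 D :=
    Metric.ball_subset_ball (by linarith)
  have := norm_sub_le_mul_pow_succ (convex_ball (0 : ℂ) (D / 2)) (k := 2)
    (f := fun w => L w - deriv L a * (w - a) - iteratedDeriv 2 L a * (w - a) ^ 2 / 2)
    (f' := fun w => deriv L w - deriv L a - iteratedDeriv 2 L a * (w - a)) (a := a)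
    (fun w hw => ?_) (mem_ball_zero_iff.2 ha)
    (by positivity : 0 ≤ 384 * A / D) (fun w hw => ?_)
    (mem_ball_zero_iff.2 hz)
  · refine le_trans (le_of_eq ?_) this
    congr 1
    simp
    ring
  · have h := (hL w (hsub hw)).differentiableAt.hasDerivAt
    have h1 := (hasDerivAt_id w).sub_const a
    convert! (h.sub (h1.const_mul (deriv L a))).sub
      (((h1.pow 2).const_mul (iteratedDeriv 2 L a)).div_const 2) using 1
    simp
    ring
  · exact norm_deriv_sub_taylor_le hD hL hA hA0 ha (mem_ball_zero_iff.1 hw)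

theorem norm_sub_taylor_zero_le (hD : 0 < D) (hL : AnalyticOnNhd ℂ L (Metric.ball 0 D))
    (hA : ∀ z, ‖z‖ < D → ‖L z‖ ≤ A * D ^ 2) (hA0 : 0 ≤ A) (h0 : L 0 = 0) (h1 : deriv L 0 = 0)
    (h2 : iteratedDeriv 2 L 0 = 1) {z : ℂ} (hz : ‖z‖ < D / 2) :
    ‖L z - z ^ 2 / 2 - iteratedDeriv 3 L 0 * z ^ 3 / 6‖ ≤ 6144 * A / D ^ 2 * ‖z‖ ^ 4 := by
  have hsub : Metric.ball (0 : ℂ) (D / 2) ⊆ Metric.ball 0 D :=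
    Metric.ball_subset_ball (by linarith)
  have hc : 0 ≤ 6144 * A / D ^ 2 := by positivity
  have hs := convex_ball (0 : ℂ) (D / 2)
  have hm : (0 : ℂ) ∈ Metric.ball (0 : ℂ) (D / 2) := Metric.mem_ball_self (by positivity)
  set γ := iteratedDeriv 3 L 0 with hγ
  have s3 : ∀ w ∈ Metric.ball (0 : ℂ) (D / 2),
      ‖iteratedDeriv 3 L w - γ‖ ≤ 6144 * A / D ^ 2 * ‖w - 0‖ ^ 1 := fun w hw =>
    norm_sub_le_mul_pow_succ hs (k := 0) (fun w hw => hL.hasDerivAt_iteratedDeriv 3 (hsub hw)) hm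
      hc (fun w hw => by
        simpa using norm_iteratedDeriv_four_le hD hL hA (mem_ball_zero_iff.1 hw)) hw
  have s2 : ∀ w ∈ Metric.ball (0 : ℂ) (D / 2),
      ‖iteratedDeriv 2 L w - 1 - γ * w‖ ≤ 6144 * A / D ^ 2 * ‖w - 0‖ ^ 2 := by
    intro w hw
    have := norm_sub_le_mul_pow_succ hs (f := fun w => iteratedDeriv 2 L w - γ * w)
      (f' := fun w => iteratedDeriv 3 L w - γ) (k := 1)
      (fun w hw => by
        convert! (hL.hasDerivAt_iteratedDeriv 2 (hsub hw)).sub ((hasDerivAt_id w).const_mul γ)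
          using 1
        simp)
      hm hc (fun w hw => by simpa using s3 w hw) hw
    simpa [h2, sub_right_comm] using this
  have s1 : ∀ w ∈ Metric.ball (0 : ℂ) (D / 2),
      ‖deriv L w - w - γ * w ^ 2 / 2‖ ≤ 6144 * A / D ^ 2 * ‖w - 0‖ ^ 3 := by
    intro w hw
    have := norm_sub_le_mul_pow_succ hs (f := fun w => deriv L w - w - γ * w ^ 2 / 2)
      (f' := fun w => iteratedDeriv 2 L w - 1 - γ * w) (fun w hw => ?_) hm hc s2 hw
    · simpa [h1] using this
    · have h := hL.hasDerivAt_iteratedDeriv 1 (hsub hw)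
      rw [iteratedDeriv_one] at h
      convert! (h.sub (hasDerivAt_id w)).sub ((((hasDerivAt_id w).pow 2).const_mul γ).div_const 2)
        using 1
      simp
      ring
  have := norm_sub_le_mul_pow_succ hs (f := fun w => L w - w ^ 2 / 2 - γ * w ^ 3 / 6)
      (f' := fun w => deriv L w - w - γ * w ^ 2 / 2) (fun w hw => ?_) hm hc s1
      (mem_ball_zero_iff.2 hz)
  · simpa [h0] using this
  · have h := (hL w (hsub hw)).differentiableAt.hasDerivAt
    convert! (h.sub (((hasDerivAt_id w).pow 2).div_const 2)).sub
      ((((hasDerivAt_id w).pow 3).const_mul γ).div_const 6) using 1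
    simp
    ring

end Taylor

/-! ### Agreement of the complex and real cumulant generating functions. -/

namespace IsAnalyticCGF

variable {Ω : Type*} [MeasurableSpace Ω] {X : Ω → ℝ} {P : Measure Ω} {H : ℝ} {L : ℂ → ℂ}

theorem mem_interior_integrableExpSet (hL : IsAnalyticCGF X P H L) {t : ℝ} (ht : |t| < H) :
    t ∈ interior (integrableExpSet X P) :=
  mem_interior.2 ⟨Set.Ioo (-H) H, fun s hs => hL.integrable_exp s (abs_lt.2 hs), isOpen_Ioo,
    abs_lt.1 ht⟩

theorem ofReal_mem_ball {t : ℝ} (ht : |t| < H) : (t : ℂ) ∈ Metric.ball (0 : ℂ) H := by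
  simpa using ht

/-- The difference of the two has exponential 1 on the real interval; differentiating this identity
shows that its derivative vanishes, and it is 0 at the origin. No integer multiple of `2πi` has to
be tracked. -/
theorem ofReal_eq_cgf [IsProbabilityMeasure P] (hL : IsAnalyticCGF X P H L) {t : ℝ}
    (ht : |t| < H) : L t = cgf X P t := by
  have hexp : ∀ s ∈ Set.Ioo (-H) H, Complex.exp (L s - cgf X P s) = 1 := by
    intro s hs
    have hs' : |s| < H := abs_lt.2 hs
    rw [Complex.exp_sub, hL.exp_eq s (ofReal_mem_ball hs'), complexMGF_ofReal,
      ← Complex.ofReal_exp, exp_cgf (hL.integrable_exp s hs'), div_self]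
    exact_mod_cast (mgf_pos (hL.integrable_exp s hs')).ne'
  have hder : ∀ s ∈ Set.Ioo (-H) H, HasDerivAt (fun s : ℝ => L s - cgf X P s) 0 s := by
    intro s hs
    have hs' : |s| < H := abs_lt.2 hs
    have h1 := ((hL.analytic s (ofReal_mem_ball hs')).differentiableAt.hasDerivAt.comp_ofReal).sub
      (analyticAt_cgf (hL.mem_interior_integrableExpSet hs')).differentiableAt.hasDerivAt.ofReal_comp
    have h2 := h1.cexp
    have h3 : HasDerivAt (fun _ : ℝ => (1 : ℂ)) 0 s := hasDerivAt_const s 1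
    have h4 := h2.unique (h3.congr_of_eventuallyEq
      (Filter.mem_of_superset (isOpen_Ioo.mem_nhds hs) hexp))
    have h5 := (mul_eq_zero.1 h4).resolve_left (Complex.exp_ne_zero _)
    rw [h5] at h1
    exact h1
  have h0 : (0 : ℝ) ∈ Set.Ioo (-H) H := by
    have := (abs_nonneg t).trans_lt ht
    exact ⟨by linarith, this⟩
  have hc := (convex_Ioo (-H) H).norm_image_sub_le_of_norm_hasDerivWithin_le (C := 0)
    (fun s hs => (hder s hs).hasDerivWithinAt) (by simp) h0 (abs_lt.1 ht)
  have : L t - cgf X P t = 0 := by simpa [hL.map_zero] using hc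
  exact sub_eq_zero.1 this

theorem iteratedDeriv_ofReal [IsProbabilityMeasure P] (hL : IsAnalyticCGF X P H L) (k : ℕ) {t : ℝ}
    (ht : |t| < H) : iteratedDeriv k L t = iteratedDeriv k (cgf X P) t := by
  induction k generalizing t with
  | zero => simpa using hL.ofReal_eq_cgf ht
  | succ k ih =>
    have h1 := (hL.analytic.hasDerivAt_iteratedDeriv k (ofReal_mem_ball ht)).comp_ofReal
    have h2 := (analyticOnNhd_cgf.hasDerivAt_iteratedDeriv k (hL.mem_interior_integrableExpSet ht)).ofReal_comp
    refine h1.unique (h2.congr_of_eventuallyEq ?_)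
    filter_upwards [isOpen_Ioo.mem_nhds (abs_lt.1 ht)] with s hs
    exact ih (abs_lt.2 hs)

end IsAnalyticCGF

/-! ### Exponential change of measure and its normal approximation. -/

section Tilt

variable {Ω : Type*} [MeasurableSpace Ω] {P : Measure Ω} {Z : Ω → ℝ}

/-- The law of `Z` under the exponential change of measure with parameter `x`. -/
noncomputable def tiltedLaw (P : Measure Ω) (Z : Ω → ℝ) (x : ℝ) : Measure ℝ :=
  (P.tilted fun ω => x * Z ω).map Z

theorem isProbabilityMeasure_tiltedLaw [IsProbabilityMeasure P] (hZ : AEMeasurable Z P) {x : ℝ}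
    (hx : Integrable (fun ω => Real.exp (x * Z ω)) P) : IsProbabilityMeasure (tiltedLaw P Z x) := by
  have := isProbabilityMeasure_tilted hx
  exact Measure.isProbabilityMeasure_map (hZ.mono_ac (tilted_absolutelyContinuous P _))

theorem integrable_id_tiltedLaw {x : ℝ} (hx : x ∈ interior (integrableExpSet Z P)) :
    Integrable id (tiltedLaw P Z x) := by
  have hZ := aemeasurable_of_mem_interior_integrableExpSet hx
  have h := memLp_tilted_mul hx 1
  rw [tiltedLaw, integrable_map_measure (by fun_prop)
    (hZ.mono_ac (tilted_absolutelyContinuous P _))]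
  exact memLp_one_iff_integrable.1 (by simpa using h)

theorem charFun_tiltedLaw (hZ : AEMeasurable Z P) (x t : ℝ) :
    charFun (tiltedLaw P Z x) t = complexMGF Z P (x + t * Complex.I) / mgf Z P x := by
  rw [tiltedLaw, ← complexMGF_mul_I (hZ.mono_ac (tilted_absolutelyContinuous P _)), complexMGF,
    integral_tilted_mul_eq_mgf, complexMGF, ← integral_div]
  congr 1
  ext ω
  rw [add_mul, Complex.exp_add, Complex.real_smul]
  push_cast
  ring

/-- Undoing the tilt multiplies by `e^{k(x) - xy}`, where `k` is `cgf Z P`; on `y ≥ x` this is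
`e^{k(x) - x²}` times `e^{-x(y - x)}`. -/
theorem measureReal_ge_eq_integral_expTail [IsProbabilityMeasure P] (hZ : AEMeasurable Z P) {x : ℝ}
    (hx : Integrable (fun ω => Real.exp (x * Z ω)) P) :
    P.real {ω | x ≤ Z ω} =
      Real.exp (cgf Z P x - x ^ 2) * ∫ y, expTail x x y ∂(tiltedLaw P Z x) := by
  have hm : NullMeasurableSet {ω | x ≤ Z ω} P := nullMeasurableSet_le aemeasurable_const hZ
  rw [tiltedLaw, integral_map (hZ.mono_ac (tilted_absolutelyContinuous P _))
    (measurable_expTail x x).aestronglyMeasurable, integral_tilted_mul_eq_mgf,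
    ← integral_const_mul]
  have : ∀ ω, Real.exp (cgf Z P x - x ^ 2) *
      (Real.exp (x * Z ω) / mgf Z P x) • expTail x x (Z ω) =
        {ω | x ≤ Z ω}.indicator (fun _ => (1 : ℝ)) ω := by
    intro ω
    simp only [expTail, Set.indicator, Set.mem_Ici, Set.mem_ofPred_eq]
    split_ifs
    · rw [Real.exp_sub, exp_cgf hx, smul_eq_mul]
      have := (mgf_pos hx).ne'
      field_simp
      rw [← Real.exp_add]
      ring_nf
    · simp
  simp only [this]
  rw [integral_indicator₀ hm]
  simp

end Tilt

theorem integrableOn_sq_mul_exp_neg_sq :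
    IntegrableOn (fun t : ℝ => t ^ 2 * Real.exp (-(t ^ 2 / 8))) (Set.Ioi 0) := by
  have := integrable_rpow_mul_exp_neg_mul_sq (b := 1 / 8) (by norm_num) (s := 2) (by norm_num)
  refine (this.congr (ae_of_all _ fun t => ?_)).integrableOn
  simp only [Real.rpow_ofNat]
  ring_nf

/-- The Berry–Esseen bound for the tilted law. -/
theorem exists_berryEsseen_tiltedLaw {Ω : Type*} [MeasurableSpace Ω] (P : Measure Ω)
    [IsProbabilityMeasure P] {A : ℝ} (hA1 : 1 ≤ A) :
    ∃ C : ℝ, 0 < C ∧ ∀ (Z : Ω → ℝ) (L : ℂ → ℂ) (D x : ℝ), AEMeasurable Z P → 0 < D →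
      IsAnalyticCGF Z P D L → (∀ z, ‖z‖ < D → ‖L z‖ ≤ A * D ^ 2) → iteratedDeriv 2 L 0 = 1 →
      0 ≤ x → 384 * A * x ≤ D / 2 → ∀ y,
      |(tiltedLaw P Z x).real (Set.Iio y) - (gaussianReal (deriv (cgf Z P) x)
        (iteratedDeriv 2 (cgf Z P) x).toNNReal).real (Set.Iio y)| ≤ C / D := by
  obtain ⟨C, hC, hsm⟩ := exists_esseen_smoothing
  set I := ∫ t in Set.Ioi (0 : ℝ), t ^ 2 * Real.exp (-(t ^ 2 / 8)) with hI
  have hI0 : 0 ≤ I := setIntegral_nonneg measurableSet_Ioi fun t _ => by positivity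
  -- The two terms are `D ∫ g` and `D l/T`, with `l = 1` and `T = D/(8c)`.
  refine ⟨C * (384 * A * I + 8 * (384 * A)), by positivity, ?_⟩
  intro Z L D x hZ hD hL hA h2 hx0 hx y
  set c := 384 * A with hc
  have hc1 : 384 ≤ c := by rw [hc]; linarith
  have hxD : x < D / 4 := by nlinarith
  have hxD' : |x| < D := by rw [abs_of_nonneg hx0]; linarith
  have hxn : ‖(x : ℂ)‖ < D / 2 := by
    rw [Complex.norm_real, Real.norm_of_nonneg hx0]; linarith
  set m := deriv (cgf Z P) x with hm
  set σ := iteratedDeriv 2 (cgf Z P) x with hσ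
  have hmL : deriv L x = m := by
    have := hL.iteratedDeriv_ofReal 1 hxD'
    rwa [iteratedDeriv_one, iteratedDeriv_one] at this
  have hσL : iteratedDeriv 2 L x = σ := hL.iteratedDeriv_ofReal 2 hxD'
  have hσ1 : |σ - 1| ≤ 1 / 2 := by
    have h := norm_iteratedDeriv_two_sub_le hD hL.analytic hA (by linarith) (a := 0) (by simpa)
      hxn
    rw [h2, hσL, sub_zero, Complex.norm_real, Real.norm_of_nonneg hx0, ← Complex.ofReal_one,
      ← Complex.ofReal_sub, Complex.norm_real, Real.norm_eq_abs] at h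
    refine h.trans ?_
    rw [div_mul_eq_mul_div, div_le_iff₀ hD]
    linarith
  have hσ2 : 1 / 2 ≤ σ := by linarith [(abs_le.1 hσ1).1]
  have hv : ((σ.toNNReal : NNReal) : ℝ) = σ := Real.coe_toNNReal σ (by linarith)
  have hint := hL.integrable_exp x hxD'
  have := isProbabilityMeasure_tiltedLaw hZ hint
  set g : ℝ → ℝ := fun t => c / D * (t ^ 2 * Real.exp (-(t ^ 2 / 8))) with hg
  have key := hsm (tiltedLaw P Z x) (gaussianReal m σ.toNNReal)
    (integrable_id_tiltedLaw (hL.mem_interior_integrableExpSet hxD'))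
    (memLp_one_iff_integrable.1 (by simpa using memLp_id_gaussianReal 1))
    1 (D / (8 * c)) zero_le_one (by positivity)
    (gaussianReal_real_Iio_add_le m (by
      rw [← NNReal.coe_le_coe, hv]; simpa using hσ2)) g
    (fun t => by rw [hg]; positivity) (integrableOn_sq_mul_exp_neg_sq.const_mul _) ?_ y
  · refine key.trans (le_of_eq ?_)
    rw [hg, integral_const_mul, ← hI]
    field_simp
  · intro t ht htT
    have htD : t * (8 * c) ≤ D := (le_div_iff₀ (by positivity)).1 htT
    have hzn : ‖(x : ℂ) + t * Complex.I‖ < D / 2 := by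
      refine (norm_add_le _ _).trans_lt ?_
      rw [norm_mul, Complex.norm_I, mul_one, Complex.norm_real, Complex.norm_real,
        Real.norm_of_nonneg hx0, Real.norm_of_nonneg ht.le]
      nlinarith
    set z : ℂ := (x : ℂ) + t * Complex.I with hz
    set R := L z - L x - deriv L x * (z - x) - iteratedDeriv 2 L x * (z - x) ^ 2 / 2 with hR
    have hzx : z - x = t * Complex.I := by rw [hz]; ring
    have hRle : ‖R‖ ≤ c / D * t ^ 3 := by
      have := norm_sub_taylor_le hD hL.analytic hA (by linarith) hxn hzn
      rwa [hzx, norm_mul, Complex.norm_I, mul_one, Complex.norm_real, Real.norm_of_nonneg ht.le,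
        ← hzx] at this
    -- The cutoff `T = D/(8c)` is chosen for this bound: `e^{‖R‖}` then uses up only half of the
    -- Gaussian decay `e^{-t²/4}` that `σ ≥ 1/2` provides.
    have hRle2 : ‖R‖ ≤ t ^ 2 / 8 := by
      refine hRle.trans ?_
      rw [div_mul_eq_mul_div, div_le_iff₀ hD]
      have : t ^ 2 * (t * (8 * c)) ≤ t ^ 2 * D := by gcongr
      linarith
    have hQ : charFun (tiltedLaw P Z x) t =
        Complex.exp (t * m * Complex.I - σ * t ^ 2 / 2) * Complex.exp R := by
      rw [charFun_tiltedLaw hZ, ← complexMGF_ofReal, ← hL.exp_eq _ (IsAnalyticCGF.ofReal_mem_ball hxD'),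
        ← hL.exp_eq _ (by rw [mem_ball_zero_iff]; linarith), ← Complex.exp_sub, ← Complex.exp_add]
      congr 1
      rw [hR, hzx, hmL, hσL, mul_pow, Complex.I_sq]
      ring
    have hN : charFun (gaussianReal m σ.toNNReal) t =
        Complex.exp (t * m * Complex.I - σ * t ^ 2 / 2) := by
      rw [charFun_gaussianReal, ← hv]
      simp
    have hE : ‖Complex.exp (t * m * Complex.I - σ * t ^ 2 / 2)‖ ≤ Real.exp (-(t ^ 2 / 4)) := by
      rw [Complex.norm_exp]
      refine Real.exp_le_exp.2 ?_
      have : ((t : ℂ) * m * Complex.I - σ * t ^ 2 / 2).re = -(σ * t ^ 2 / 2) := by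
        rw [show (t : ℂ) * m * Complex.I - σ * t ^ 2 / 2 =
          ((-(σ * t ^ 2 / 2) : ℝ) : ℂ) + ((t * m : ℝ) : ℂ) * Complex.I by push_cast; ring,
          Complex.add_re, Complex.ofReal_re, Complex.re_ofReal_mul, Complex.I_re, mul_zero, add_zero]
      rw [this]
      nlinarith [sq_nonneg t]
    have hR1 : ‖Complex.exp R - 1‖ ≤ ‖R‖ * Real.exp ‖R‖ := by
      simpa using Complex.norm_exp_sub_sum_le_norm_mul_exp R 1
    rw [hQ, hN, ← mul_sub_one, norm_mul]
    calc _ ≤ Real.exp (-(t ^ 2 / 4)) * (c / D * t ^ 3 * Real.exp (t ^ 2 / 8)) := by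
          gcongr
          exact hR1.trans (by gcongr)
      _ = t * (c / D * (t ^ 2 * (Real.exp (-(t ^ 2 / 4)) * Real.exp (t ^ 2 / 8)))) := by ring
      _ = t * g t := by
          rw [hg, ← Real.exp_add]
          ring_nf

/-! ### Large deviations for one normalized variable. -/

/-- If `4cx² > D`, then multiplying by `x` and using `x³ ≤ KD` forces `x < 4cK`, so `D` would be
below a fixed constant. Thus large `D` makes the corrections of order `x/D` and `x²/D` small. -/
theorem le_of_cube_le {x K c D : ℝ} (hx : 0 ≤ x) (hc : 2 ≤ c)
    (hD : K ^ 2 * (4 * c) ^ 3 + 4 * c ≤ D) (h : x ^ 3 ≤ K * D) :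
    4 * c * x ^ 2 ≤ D ∧ 2 * c * x ≤ D := by
  have hD0 : 0 < D := by
    have : 0 ≤ K ^ 2 * (4 * c) ^ 3 := by positivity
    linarith
  have h1 : 4 * c * x ^ 2 ≤ D := by
    by_contra! hlt
    have hx0 : 0 < x := by
      rcases hx.eq_or_lt with rfl | h0
      · simp at hlt; linarith
      · exact h0
    have h2 : x < 4 * c * K := by
      have : x * D < 4 * c * K * D := by
        calc x * D < x * (4 * c * x ^ 2) := by gcongr
          _ = 4 * c * x ^ 3 := by ring
          _ ≤ 4 * c * (K * D) := by gcongr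
          _ = _ := by ring
      exact lt_of_mul_lt_mul_right this hD0.le
    have h3 : 4 * c * x ^ 2 ≤ 4 * c * (4 * c * K) ^ 2 := by gcongr
    have h4 : 4 * c * (4 * c * K) ^ 2 = K ^ 2 * (4 * c) ^ 3 := by ring
    linarith
  refine ⟨h1, ?_⟩
  have h5 : 0 ≤ K ^ 2 * (4 * c) ^ 3 := by positivity
  nlinarith [sq_nonneg (x - 1)]

/-- The tail of the normal law against the tail of a normalized random variable with analytic
cumulant generating function, in the range `x ^ 3 = O(D)`. -/
theorem exists_largeDeviation {Ω : Type*} [MeasurableSpace Ω] (P : Measure Ω)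
    [IsProbabilityMeasure P] {A K : ℝ} (hA1 : 1 ≤ A) (hK : 0 ≤ K) :
    ∃ M D₀ : ℝ, ∀ (Z : Ω → ℝ) (L : ℂ → ℂ) (D x : ℝ), AEMeasurable Z P → D₀ ≤ D → 0 < D →
      IsAnalyticCGF Z P D L → (∀ z, ‖z‖ < D → ‖L z‖ ≤ A * D ^ 2) → deriv L 0 = 0 →
      iteratedDeriv 2 L 0 = 1 → 0 ≤ x → x ^ 3 ≤ K * D →
      |P.real {ω | x ≤ Z ω} - (1 - stdNormalDF x) * Real.exp (cumulant 3 Z P * x ^ 3 / 6)| ≤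
        M * (Real.exp (-x ^ 2 / 2) / D) := by
  obtain ⟨C, hC, hBE⟩ := exists_berryEsseen_tiltedLaw P hA1
  set c := 384 * A with hc
  have hc1 : 384 ≤ c := by rw [hc]; linarith
  -- The factor 3 bounds `e^r`, `2C` comes from the Berry–Esseen step, `6(10c + c²K)` from changing
  -- the Gaussian parameters, and `32cK` from `ψ |e^r - 1|`.
  refine ⟨Real.exp (c * K / 6) * (3 * (2 * C + 6 * (10 * c + c ^ 2 * K)) + 32 * c * K),
    K ^ 2 * (4 * c) ^ 3 + 4 * c, ?_⟩
  intro Z L D x hZ hD0 hD hL hA h1 h2 hx0 hxK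
  obtain ⟨hx2, hx1⟩ := le_of_cube_le hx0 (by linarith) hD0 hxK
  have hxD : x < D / 2 := by nlinarith
  have hxD' : |x| < D := by rw [abs_of_nonneg hx0]; linarith
  have hxn : ‖(x : ℂ)‖ < D / 2 := by rwa [Complex.norm_real, Real.norm_of_nonneg hx0]
  have hint := hL.integrable_exp x hxD'
  have hA0 : 0 ≤ A := by linarith
  set m := deriv (cgf Z P) x with hm
  set σ := iteratedDeriv 2 (cgf Z P) x with hσ
  set γ := cumulant 3 Z P with hγ
  have hmL : deriv L x = m := by
    have := hL.iteratedDeriv_ofReal 1 hxD'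
    rwa [iteratedDeriv_one, iteratedDeriv_one] at this
  have hσL : iteratedDeriv 2 L x = σ := hL.iteratedDeriv_ofReal 2 hxD'
  have hγL : iteratedDeriv 3 L 0 = γ := by
    have := hL.iteratedDeriv_ofReal 3 (t := 0) (by simpa)
    rwa [Complex.ofReal_zero] at this
  have hσ1 : |σ - 1| ≤ c / D * x := by
    have h := norm_iteratedDeriv_two_sub_le hD hL.analytic hA hA0 (a := 0) (by simpa) hxn
    rwa [h2, hσL, sub_zero, Complex.norm_real, Real.norm_of_nonneg hx0, ← Complex.ofReal_one,
      ← Complex.ofReal_sub, Complex.norm_real, Real.norm_eq_abs] at h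
  have hm1 : |m - x| ≤ c / D * x ^ 2 := by
    have h := norm_deriv_sub_taylor_le hD hL.analytic hA hA0 (a := 0) (by simpa) hxn
    rwa [h1, h2, hmL, sub_zero, sub_zero, one_mul, Complex.norm_real, Real.norm_of_nonneg hx0,
      ← Complex.ofReal_sub, Complex.norm_real, Real.norm_eq_abs] at h
  set r := cgf Z P x - x ^ 2 / 2 - γ * x ^ 3 / 6 with hr
  have hr1 : |r| ≤ 16 * c / D ^ 2 * x ^ 4 := by
    have h := norm_sub_taylor_zero_le hD hL.analytic hA hA0 hL.map_zero h1 h2 hxn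
    rw [hL.ofReal_eq_cgf hxD', hγL, Complex.norm_real, Real.norm_of_nonneg hx0] at h
    have hcast : ((cgf Z P x : ℂ) - (x : ℂ) ^ 2 / 2 - (γ : ℂ) * (x : ℂ) ^ 3 / 6) = (r : ℂ) := by
      rw [hr]; push_cast; ring
    rw [hcast, Complex.norm_real, Real.norm_eq_abs] at h
    refine h.trans (le_of_eq ?_)
    rw [hc]; ring
  have hγ1 : |γ| ≤ c / D := by
    have h := norm_iteratedDeriv_three_le hD hL.analytic hA (z := 0) (by simpa)
    rwa [hγL, Complex.norm_real, Real.norm_eq_abs] at h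
  have hr2 : |r| ≤ 1 := by
    refine hr1.trans ?_
    rw [div_mul_eq_mul_div, div_le_one (by positivity)]
    have : (4 * c * x ^ 2) ^ 2 ≤ D ^ 2 := by gcongr
    have h4 : 0 ≤ x ^ 4 := by positivity
    nlinarith
  have hexpγ : Real.exp (γ * x ^ 3 / 6) ≤ Real.exp (c * K / 6) := by
    refine Real.exp_le_exp.2 ?_
    have : γ * x ^ 3 ≤ c / D * (K * D) := by
      have := le_abs_self γ
      gcongr
      linarith
    rw [show c / D * (K * D) = c * K by field_simp] at this
    linarith
  have hxD3 : x ^ 3 / D ≤ K := (div_le_iff₀ hD).2 hxK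
  have hσhalf : |σ - 1| ≤ 1 / 2 := by
    refine hσ1.trans ?_
    rw [div_mul_eq_mul_div, div_le_iff₀ hD]
    linarith
  have hmhalf : |m - x| ≤ 1 / 2 := by
    refine hm1.trans ?_
    rw [div_mul_eq_mul_div, div_le_iff₀ hD]
    nlinarith
  have hv : ((σ.toNNReal : NNReal) : ℝ) = σ :=
    Real.coe_toNNReal σ (by linarith [(abs_le.1 hσhalf).1])
  have hv0 : σ.toNNReal ≠ 0 := by
    rw [← NNReal.coe_ne_zero, hv]
    linarith [(abs_le.1 hσhalf).1]
  have := isProbabilityMeasure_tiltedLaw hZ hint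
  set ψ := gaussianHalfLaplace 0 1 x with hψ
  set IQ := ∫ y, expTail x x y ∂(tiltedLaw P Z x) with hIQ
  have hQN : |IQ - gaussianHalfLaplace (m - x) σ.toNNReal x| ≤ 2 * (C / D) := by
    rw [← integral_expTail_gaussianReal m x x hv0]
    exact abs_integral_expTail_sub_le _ _
      (hBE Z L D x hZ hD hL hA h2 hx0 (by linarith)) hx0 x
  have hNψ : |gaussianHalfLaplace (m - x) σ.toNNReal x - ψ| ≤ 6 * (10 * c + c ^ 2 * K) / D := by
    -- The Gaussian comparison divides by `x`; at `x = 0` the parameters are exactly 0 and 1, so the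
    -- difference vanishes.
    rcases hx0.eq_or_lt with hx | hx
    · have e1 : m - x = 0 := by
        rw [← hx] at hm1; simpa [← hx] using hm1
      have e2 : σ.toNNReal = 1 := by
        have : σ - 1 = 0 := by rw [← hx] at hσ1; simpa using hσ1
        rw [sub_eq_zero.1 this, Real.toNNReal_one]
      rw [e1, e2, ← hψ, sub_self, abs_zero]
      positivity
    · have := abs_gaussianHalfLaplace_sub_le (v := σ.toNNReal) hmhalf (by rwa [hv]) hx
      rw [hv] at this
      refine this.trans ?_
      have hsq : (m - x) ^ 2 ≤ (c / D * x ^ 2) ^ 2 := by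
        rw [← sq_abs]; gcongr
      calc _ ≤ 6 / x * (4 * (c / D * x ^ 2) / x + ((c / D * x ^ 2) ^ 2 + 6 * (c / D * x))) := by
            gcongr
        _ = 6 * (10 * c + c ^ 2 * (x ^ 3 / D)) / D := by field_simp; ring
        _ ≤ _ := by gcongr
  -- The Mills bound `xψ ≤ 1` trades one power of `x`, reducing `x⁴/D²` to `x³/D² ≤ K/D`.
  have hψr : ψ * |r| ≤ 16 * c * K / D := by
    have h0 : 0 ≤ ψ := gaussianHalfLaplace_nonneg 0 1 x
    calc ψ * |r| ≤ ψ * (16 * c / D ^ 2 * x ^ 4) := by gcongr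
      _ = (x * ψ) * (16 * c * (x ^ 3 / D) / D) := by field_simp
      _ ≤ 1 * (16 * c * K / D) := by
          have := mul_gaussianHalfLaplace_le_one hx0
          gcongr
      _ = _ := one_mul _
  have hcomb : |Real.exp r * IQ - ψ| ≤
      (3 * (2 * C + 6 * (10 * c + c ^ 2 * K)) + 32 * c * K) / D := by
    have h0 : 0 ≤ ψ := gaussianHalfLaplace_nonneg 0 1 x
    have e1 : |IQ - ψ| ≤ 2 * (C / D) + 6 * (10 * c + c ^ 2 * K) / D :=
      (abs_sub_le _ _ _).trans (add_le_add hQN hNψ)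
    have e2 : Real.exp r ≤ 3 :=
      (Real.exp_le_exp.2 ((le_abs_self r).trans hr2)).trans Real.exp_one_lt_three.le
    have e3 : |Real.exp r - 1| ≤ 2 * |r| := Real.abs_exp_sub_one_le hr2
    have e4 : Real.exp r * IQ - ψ = Real.exp r * (IQ - ψ) + ψ * (Real.exp r - 1) := by ring
    rw [e4]
    calc _ ≤ |Real.exp r * (IQ - ψ)| + |ψ * (Real.exp r - 1)| := abs_add_le _ _
      _ = Real.exp r * |IQ - ψ| + ψ * |Real.exp r - 1| := by
          rw [abs_mul, abs_mul, abs_of_nonneg h0, abs_of_pos (Real.exp_pos r)]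
      _ ≤ 3 * (2 * (C / D) + 6 * (10 * c + c ^ 2 * K) / D) + ψ * (2 * |r|) := by gcongr
      _ = 3 * (2 * (C / D) + 6 * (10 * c + c ^ 2 * K) / D) + 2 * (ψ * |r|) := by ring
      _ ≤ 3 * (2 * (C / D) + 6 * (10 * c + c ^ 2 * K) / D) + 2 * (16 * c * K / D) := by gcongr
      _ = _ := by ring
  have hmain : P.real {ω | x ≤ Z ω} - (1 - stdNormalDF x) * Real.exp (γ * x ^ 3 / 6) =
      Real.exp (-x ^ 2 / 2) * Real.exp (γ * x ^ 3 / 6) * (Real.exp r * IQ - ψ) := by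
    rw [measureReal_ge_eq_integral_expTail hZ hint, one_sub_stdNormalDF, ← hIQ, ← hψ,
      show cgf Z P x - x ^ 2 = -x ^ 2 / 2 + γ * x ^ 3 / 6 + r by rw [hr]; ring,
      Real.exp_add, Real.exp_add]
    ring
  rw [hmain, abs_mul, abs_of_pos (by positivity)]
  calc _ ≤ Real.exp (-x ^ 2 / 2) * Real.exp (c * K / 6) *
        ((3 * (2 * C + 6 * (10 * c + c ^ 2 * K)) + 32 * c * K) / D) := by gcongr
    _ = _ := by ring

/-! ### Series of analytic functions and lattice sums. -/

/-- Termwise differentiation, by induction on the order: each step halves the radius, and Cauchy's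
estimate gives the derivatives a summable majorant again. -/
theorem hasSum_iteratedDeriv_of_norm_le {ι : Type*} (k : ℕ) {R : ℝ} (hR : 0 < R)
    {F : ι → ℂ → ℂ} {c : ι → ℝ} (hc : Summable c)
    (hF : ∀ j, AnalyticOnNhd ℂ (F j) (Metric.ball 0 R)) (hFc : ∀ j z, ‖z‖ < R → ‖F j z‖ ≤ c j) :
    HasSum (fun j => iteratedDeriv k (F j) 0) (iteratedDeriv k (fun z => ∑' j, F j z) 0) := by
  induction k generalizing R F c with
  | zero =>
    simp only [iteratedDeriv_zero]
    exact (Summable.of_norm_bounded hc fun j => hFc j 0 (by simpa)).hasSum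
  | succ k ih =>
    have hsub : Metric.ball (0 : ℂ) (R / 2) ⊆ Metric.ball 0 R :=
      Metric.ball_subset_ball (by linarith)
    have h := ih (R := R / 2) (by positivity) (F := fun j => deriv (F j))
      (c := fun j => Nat.factorial 1 * c j / (R / 4) ^ 1) ((hc.mul_left _).div_const _)
      (fun j => (hF j).deriv.mono hsub) (fun j z hz => by
        rw [← iteratedDeriv_one]
        exact norm_iteratedDeriv_le_of_norm_le hR (hF j) (hFc j) 1 hz)
    have heq : (fun z => ∑' j, deriv (F j) z) =ᶠ[𝓝 0] deriv fun z => ∑' j, F j z := by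
      filter_upwards [Metric.isOpen_ball.mem_nhds (Metric.mem_ball_self hR)] with z hz
      exact (Complex.hasSum_deriv_of_summable_norm hc (fun j => (hF j).differentiableOn)
        Metric.isOpen_ball (fun j w hw => hFc j w (mem_ball_zero_iff.1 hw)) hz).tsum_eq
    simp only [iteratedDeriv_succ']
    rwa [heq.iteratedDeriv_eq] at h

theorem iteratedDeriv_comp_mul_left {𝕜 F : Type*} [NontriviallyNormedField 𝕜]
    [NormedAddCommGroup F] [NormedSpace 𝕜 F] (a : 𝕜) (f : 𝕜 → F) (k : ℕ) :
    iteratedDeriv k (fun x => f (a * x)) = fun x => a ^ k • iteratedDeriv k f (a * x) := by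
  induction k with
  | zero => simp
  | succ k ih =>
    ext x
    rw [iteratedDeriv_succ, ih, deriv_fun_const_smul_field, iteratedDeriv_succ,
      deriv_comp_mul_left, smul_smul, pow_succ]

theorem tendsto_latticeCube (d : ℕ) : Tendsto (latticeCube d) atTop atTop := by
  refine tendsto_atTop_finset_of_monotone (fun m n hmn => ?_) fun j => ?_
  · have : (m : ℤ) ≤ n := by exact_mod_cast hmn
    exact Finset.Icc_subset_Icc (fun _ => by simpa) (fun _ => by simpa)
  · refine ⟨∑ i, (j i).natAbs, Finset.mem_Icc.2 ⟨fun i => ?_, fun i => ?_⟩⟩ <;>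
    · have : (j i).natAbs ≤ ∑ i, (j i).natAbs :=
        Finset.single_le_sum (f := fun i => (j i).natAbs) (fun _ _ => Nat.zero_le _)
          (Finset.mem_univ i)
      simp only
      omega

section FiniteSums

variable {Ω : Type*} [MeasurableSpace Ω] {P : Measure Ω}
  {ι : Type*} {X : ι → Ω → ℝ} {H : ℝ} {L : ι → ℂ → ℂ} {c : ι → ℝ}

theorem charFun_map_sum_eq_exp (hX : ∀ j, AEMeasurable (X j) P) (hindep : iIndepFun X P)
    (hL : ∀ j, IsAnalyticCGF (X j) P H (L j)) (s : Finset ι) {t : ℝ} (ht : |t| < H) :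
    charFun (P.map fun ω => ∑ j ∈ s, X j ω) t = Complex.exp (∑ j ∈ s, L j (t * Complex.I)) := by
  rw [(hindep.restrict s).charFun_map_fun_finsetSum_eq_prod fun j _ => hX j, Finset.prod_apply,
    Complex.exp_sum]
  refine Finset.prod_congr rfl fun j _ => ?_
  rw [← complexMGF_mul_I (hX j), (hL j).exp_eq]
  simpa using ht

theorem lintegral_exp_mul_sum_le [IsProbabilityMeasure P]
    (hX : ∀ j, AEMeasurable (X j) P) (hindep : iIndepFun X P)
    (hL : ∀ j, IsAnalyticCGF (X j) P H (L j)) (hc : ∀ j, 0 ≤ c j)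
    (hLc : ∀ j, ∀ z : ℂ, ‖z‖ < H → ‖L j z‖ ≤ c j) (hcsum : Summable c) (s : Finset ι) {t : ℝ}
    (ht : |t| < H) :
    ∫⁻ ω, ENNReal.ofReal (Real.exp (t * ∑ j ∈ s, X j ω)) ∂P ≤
      ENNReal.ofReal (Real.exp (∑' j, c j)) := by
  have hmgf := hindep.mgf_sum₀ hX s (t := t)
  have hpos : 0 < mgf (∑ j ∈ s, X j) P t := by
    rw [hmgf]
    exact Finset.prod_pos fun j _ => mgf_pos ((hL j).integrable_exp t ht)
  have hint : Integrable (fun ω => Real.exp (t * (∑ j ∈ s, X j) ω)) P := by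
    -- A nonintegrable exponential would have `mgf` equal to 0, the default value of the integral,
    -- against positivity of the product.
    by_contra h
    exact hpos.ne' (mgf_undef h)
  simp only [Finset.sum_apply] at hint
  rw [← ofReal_integral_eq_lintegral_ofReal hint (ae_of_all _ fun ω => (Real.exp_pos _).le)]
  refine ENNReal.ofReal_le_ofReal ?_
  have : ∫ ω, Real.exp (t * ∑ j ∈ s, X j ω) ∂P = mgf (∑ j ∈ s, X j) P t := by
    simp [mgf]
  rw [this, hmgf]
  calc ∏ j ∈ s, mgf (X j) P t ≤ ∏ j ∈ s, Real.exp (c j) := by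
        refine Finset.prod_le_prod (fun j _ => mgf_nonneg) fun j _ => ?_
        rw [← exp_cgf ((hL j).integrable_exp t ht), Real.exp_le_exp]
        have h1 := hLc j t (by simpa using ht)
        rw [(hL j).ofReal_eq_cgf ht, Complex.norm_real] at h1
        exact (le_abs_self _).trans h1
    _ = Real.exp (∑ j ∈ s, c j) := (Real.exp_sum s c).symm
    _ ≤ Real.exp (∑' j, c j) := Real.exp_le_exp.2 (hcsum.sum_le_tsum s fun j _ => hc j)

end FiniteSums

section LatticeSums

variable {Ω : Type*} [MeasurableSpace Ω] {P : Measure Ω}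
  {d : ℕ} {X : (Fin d → ℤ) → Ω → ℝ} {S : Ω → ℝ} {H : ℝ} {L : (Fin d → ℤ) → ℂ → ℂ}
  {c : (Fin d → ℤ) → ℝ}

theorem IsLatticeSum.aemeasurable (hS : IsLatticeSum X P S) (hX : ∀ j, AEMeasurable (X j) P) :
    AEMeasurable S P := by
  obtain ⟨ns, -, h⟩ := TendstoInMeasure.exists_seq_tendsto_ae hS
  exact aemeasurable_of_tendsto_metrizable_ae atTop
    (fun k => Finset.aemeasurable_fun_sum _ fun j _ => hX j) h

/-- The cumulant generating function of a lattice sum is the sum of those of the terms. -/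
theorem IsLatticeSum.isAnalyticCGF [IsProbabilityMeasure P]
    (hS : IsLatticeSum X P S) (hX : ∀ j, AEMeasurable (X j) P)
    (hindep : iIndepFun X P) (hH : 0 < H) (hL : ∀ j, IsAnalyticCGF (X j) P H (L j))
    (hc : ∀ j, 0 ≤ c j) (hLc : ∀ j, ∀ z : ℂ, ‖z‖ < H → ‖L j z‖ ≤ c j) (hcsum : Summable c) :
    IsAnalyticCGF S P H fun z => ∑' j, L j z := by
  have hSm := hS.aemeasurable hX
  obtain ⟨ns, hns, hlim⟩ := TendstoInMeasure.exists_seq_tendsto_ae hS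
  have hcube : Tendsto (fun k => latticeCube d (ns k)) atTop atTop :=
    (tendsto_latticeCube d).comp hns.tendsto_atTop
  have hsm : ∀ k, AEMeasurable (fun ω => ∑ j ∈ latticeCube d (ns k), X j ω) P :=
    fun k => Finset.aemeasurable_fun_sum _ fun j _ => hX j
  -- Fatou's lemma along an almost surely convergent subsequence, with the bound `e^{∑ c}` uniform
  -- in the cube.
  have hint : ∀ t : ℝ, |t| < H → Integrable (fun ω => Real.exp (t * S ω)) P := by
    intro t ht
    have hm : AEStronglyMeasurable (fun ω => Real.exp (t * S ω)) P :=
      (Real.measurable_exp.comp_aemeasurable (hSm.const_mul t)).aestronglyMeasurable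
    refine ⟨hm, ?_⟩
    rw [hasFiniteIntegral_iff_ofReal (ae_of_all _ fun ω => (Real.exp_pos _).le)]
    refine lt_of_le_of_lt ?_ (ENNReal.ofReal_lt_top (r := Real.exp (∑' j, c j)))
    calc ∫⁻ ω, ENNReal.ofReal (Real.exp (t * S ω)) ∂P
        = ∫⁻ ω, liminf (fun k => ENNReal.ofReal
            (Real.exp (t * ∑ j ∈ latticeCube d (ns k), X j ω))) atTop ∂P := by
          refine lintegral_congr_ae ?_
          filter_upwards [hlim] with ω hω
          refine (Tendsto.liminf_eq ?_).symm
          exact ENNReal.tendsto_ofReal ((Real.continuous_exp.tendsto _).comp (hω.const_mul t))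
      _ ≤ liminf (fun k => ∫⁻ ω, ENNReal.ofReal
            (Real.exp (t * ∑ j ∈ latticeCube d (ns k), X j ω)) ∂P) atTop :=
          lintegral_liminf_le' fun k =>
            (Real.measurable_exp.comp_aemeasurable ((hsm k).const_mul t)).ennreal_ofReal
      _ ≤ ENNReal.ofReal (Real.exp (∑' j, c j)) :=
          liminf_le_of_le (by isBoundedDefault) fun b hb => by
            obtain ⟨k, hk⟩ := hb.exists
            exact hk.trans (lintegral_exp_mul_sum_le hX hindep hL hc hLc hcsum _ ht)
  have han : AnalyticOnNhd ℂ (fun z => ∑' j, L j z) (Metric.ball 0 H) :=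
    (Complex.differentiableOn_tsum_of_summable_norm hcsum
      (fun j => (hL j).analytic.differentiableOn) Metric.isOpen_ball
      fun j w hw => hLc j w (mem_ball_zero_iff.1 hw)).analyticOnNhd Metric.isOpen_ball
  have hmgf : AnalyticOnNhd ℂ (complexMGF S P) (Metric.ball 0 H) := by
    refine analyticOnNhd_complexMGF.mono fun w hw => ?_
    have hw' : |w.re| < H := lt_of_le_of_lt (Complex.abs_re_le_norm w) (by simpa using hw)
    exact mem_interior.2 ⟨Set.Ioo (-H) H, fun t ht => hint t (abs_lt.2 ht), isOpen_Ioo,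
      abs_lt.1 hw'⟩
  -- On the imaginary axis the exponentials have modulus 1, so dominated convergence applies without
  -- uniform integrability. The identity theorem then carries the equality to the whole disc.
  have himag : ∀ t : ℝ, |t| < H →
      Complex.exp (∑' j, L j (t * Complex.I)) = complexMGF S P (t * Complex.I) := by
    intro t ht
    have htI : ‖(t : ℂ) * Complex.I‖ < H := by simpa using ht
    have h1 : Tendsto (fun k => charFun (P.map fun ω => ∑ j ∈ latticeCube d (ns k), X j ω) t)
        atTop (𝓝 (Complex.exp (∑' j, L j (t * Complex.I)))) := by
      simp only [charFun_map_sum_eq_exp hX hindep hL _ ht]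
      refine (Complex.continuous_exp.tendsto _).comp ?_
      exact (Summable.of_norm_bounded hcsum fun j => hLc j _ htI).hasSum.comp hcube
    have h2 : Tendsto (fun k => charFun (P.map fun ω => ∑ j ∈ latticeCube d (ns k), X j ω) t)
        atTop (𝓝 (complexMGF S P (t * Complex.I))) := by
      simp only [← complexMGF_mul_I (hsm _)]
      refine tendsto_integral_of_dominated_convergence (fun _ => (1 : ℝ)) (fun k => ?_)
        (integrable_const 1) (fun k => ae_of_all _ fun ω => ?_) ?_
      · have := hsm k
        exact AEMeasurable.aestronglyMeasurable (by fun_prop)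
      · rw [mul_right_comm, ← Complex.ofReal_mul, Complex.norm_exp_ofReal_mul_I]
      · filter_upwards [hlim] with ω hω
        refine (Complex.continuous_exp.tendsto _).comp (Tendsto.const_mul _ ?_)
        exact (Complex.continuous_ofReal.tendsto _).comp hω
    exact tendsto_nhds_unique h1 h2
  refine ⟨hint, han, by simp [(hL _).map_zero], ?_⟩
  refine AnalyticOnNhd.eqOn_of_preconnected_of_frequently_eq (z₀ := 0)
    (fun z hz => (han z hz).cexp) hmgf (convex_ball (0 : ℂ) H).isPreconnected
    (Metric.mem_ball_self hH) ?_
  have htend : Tendsto (fun t : ℝ => (t : ℂ) * Complex.I) (𝓝[≠] 0) (𝓝[≠] 0) := by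
    refine tendsto_nhdsWithin_iff.2 ⟨?_, ?_⟩
    · refine Tendsto.mono_left ?_ nhdsWithin_le_nhds
      have : Continuous fun t : ℝ => (t : ℂ) * Complex.I := by fun_prop
      simpa using this.tendsto 0
    · filter_upwards [self_mem_nhdsWithin] with t ht
      have : t ≠ 0 := ht
      simpa using this
  refine htend.frequently (Eventually.frequently ?_)
  filter_upwards [nhdsWithin_le_nhds (isOpen_Ioo.mem_nhds
    (⟨neg_lt_zero.2 hH, hH⟩ : (0 : ℝ) ∈ Set.Ioo (-H) H))] with t ht
  exact himag t (abs_lt.2 ht)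

theorem IsLatticeSum.hasSum_cumulant [IsProbabilityMeasure P]
    (hS : IsLatticeSum X P S) (hX : ∀ j, AEMeasurable (X j) P)
    (hindep : iIndepFun X P) (hH : 0 < H) (hL : ∀ j, IsAnalyticCGF (X j) P H (L j))
    (hc : ∀ j, 0 ≤ c j) (hLc : ∀ j, ∀ z : ℂ, ‖z‖ < H → ‖L j z‖ ≤ c j) (hcsum : Summable c)
    (k : ℕ) : HasSum (fun j => cumulant k (X j) P) (cumulant k S P) := by
  have h := hasSum_iteratedDeriv_of_norm_le k hH hcsum (fun j => (hL j).analytic) hLc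
  have h0 : |(0 : ℝ)| < H := by simpa
  have h1 := fun j => (hL j).iteratedDeriv_ofReal k h0
  have h2 := (hS.isAnalyticCGF hX hindep hH hL hc hLc hcsum).iteratedDeriv_ofReal k h0
  simp only [Complex.ofReal_zero] at h1 h2
  rw [h2] at h
  simp only [h1] at h
  exact Complex.hasSum_ofReal.1 h

end LatticeSums

/-! ### Normalization and the final theorem. -/

section Scaling

variable {Ω : Type*} [MeasurableSpace Ω] {P : Measure Ω} {X : Ω → ℝ} {H : ℝ} {L : ℂ → ℂ}

theorem IsAnalyticCGF.div_const (hL : IsAnalyticCGF X P H L) {b : ℝ} (hb : 0 < b) :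
    IsAnalyticCGF (fun ω => X ω / b) P (H * b) fun z => L ((b : ℂ)⁻¹ * z) := by
  have hmap : ∀ z ∈ Metric.ball (0 : ℂ) (H * b), (b : ℂ)⁻¹ * z ∈ Metric.ball (0 : ℂ) H := by
    intro z hz
    rw [mem_ball_zero_iff] at hz ⊢
    rwa [norm_mul, norm_inv, Complex.norm_real, Real.norm_of_nonneg hb.le, inv_mul_lt_iff₀ hb,
      mul_comm]
  refine ⟨fun t ht => ?_, ?_, by simp [hL.map_zero], fun z hz => ?_⟩
  · have := hL.integrable_exp (t / b) (by rwa [abs_div, abs_of_pos hb, div_lt_iff₀ hb])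
    refine this.congr (ae_of_all _ fun ω => ?_)
    simp only
    ring_nf
  · intro z hz
    exact (hL.analytic _ (hmap z hz)).fun_comp (by fun_prop)
  · rw [hL.exp_eq _ (hmap z hz), complexMGF, complexMGF]
    congr 1
    ext ω
    push_cast
    ring_nf

theorem cumulant_div_const (k : ℕ) (b : ℝ) :
    cumulant k (fun ω => X ω / b) P = b⁻¹ ^ k * cumulant k X P := by
  have : cgf (fun ω => X ω / b) P = fun t => cgf X P (b⁻¹ * t) := by
    ext t
    simp only [cgf, mgf]
    congr 2
    ext ω
    ring_nf
  rw [cumulant, this, iteratedDeriv_comp_mul_left]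
  simp [cumulant]

end Scaling

theorem IsAnalyticCGF.cumulant_one {Ω : Type*} [MeasurableSpace Ω] {P : Measure Ω}
    [IsProbabilityMeasure P] {X : Ω → ℝ} {H : ℝ} {L : ℂ → ℂ} (hL : IsAnalyticCGF X P H L)
    (hH : 0 < H) : cumulant 1 X P = ∫ ω, X ω ∂P := by
  rw [cumulant, iteratedDeriv_one,
    deriv_cgf_zero (hL.mem_interior_integrableExpSet (by simpa using hH))]
  simp

theorem IsAnalyticCGF.cumulant_two {Ω : Type*} [MeasurableSpace Ω] {P : Measure Ω}
    [IsProbabilityMeasure P] {X : Ω → ℝ} {H : ℝ} {L : ℂ → ℂ} (hL : IsAnalyticCGF X P H L)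
    (hH : 0 < H) : cumulant 2 X P = variance X P := by
  rw [cumulant, ← variance_tilted_mul (hL.mem_interior_integrableExpSet (by simpa using hH))]
  simp

theorem mainTheorem4 {Ω : Type*} [MeasurableSpace Ω] (P : Measure Ω) [IsProbabilityMeasure P]
    (d : ℕ) (X : ℕ → (Fin d → ℤ) → Ω → ℝ) (S : ℕ → Ω → ℝ)
    (H : ℕ → ℝ) (L : ℕ → (Fin d → ℤ) → ℂ → ℂ) (c : ℕ → (Fin d → ℤ) → ℝ)
    (hX : ∀ n j, AEMeasurable (X n j) P)
    (hmean : ∀ n j, ∫ ω, X n j ω ∂P = 0)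
    (hindep : ∀ n, iIndepFun (X n) P)
    (hH : ∀ n, 0 < H n)
    (hL : ∀ n j, IsAnalyticCGF (X n j) P (H n) (L n j))
    (hS : ∀ n, IsLatticeSum (X n) P (S n))
    (hB : ∀ n, Summable (fun j => variance (X n j) P))
    (hc : ∀ n j, 0 ≤ c n j)
    (hLc : ∀ n j, ∀ z : ℂ, ‖z‖ < H n → ‖L n j z‖ ≤ c n j)
    (hBH : Tendsto (fun n => latticeVariance (X n) P * H n ^ 2) atTop atTop)
    (hcsum : ∀ n, Summable (c n))
    (hC : (fun n => ∑' j, c n j) =O[atTop] (fun n => latticeVariance (X n) P * H n ^ 2)) :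
    (∀ n, Summable (fun j => cumulant 3 (X n j) P)) ∧
    ∀ K : ℝ, ∃ M : ℝ, ∀ᶠ n in atTop, ∀ x : ℝ, 0 ≤ x →
      x ≤ K * (H n * √(latticeVariance (X n) P)) ^ (1 / 3 : ℝ) →
      |(1 - normalizedDF (S n) (latticeVariance (X n) P) P x)
          - (1 - stdNormalDF x) *
            Real.exp (x ^ 3 / (6 * (latticeVariance (X n) P) ^ (3 / 2 : ℝ))
              * ∑' j, cumulant 3 (X n j) P)|
        ≤ M * (Real.exp (-x ^ 2 / 2) / (H n * √(latticeVariance (X n) P))) := by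

  have hsum := fun n k => (hS n).hasSum_cumulant (hX n) (hindep n) (hH n) (hL n) (hc n) (hLc n)
    (hcsum n) k
  refine ⟨fun n => (hsum n 3).summable, fun K => ?_⟩
  obtain ⟨A, hA⟩ := hC.bound
  -- The constant from the `O` bound is raised to at least 1, and the condition on `x` is cubed, so
  -- that `|K|³` plays the role of `K`.
  obtain ⟨M, D₀, hM⟩ := exists_largeDeviation P (le_max_right A 1) (pow_nonneg (abs_nonneg K) 3)
  refine ⟨M, ?_⟩
  filter_upwards [hA, hBH.eventually_ge_atTop (max D₀ 1 ^ 2)] with n hAn hDn x hx0 hxK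
  set B := latticeVariance (X n) P with hBdef
  have hB0 : 0 ≤ B := tsum_nonneg fun j => variance_nonneg _ _
  -- Besides making `D` large, the lower bound 1 guarantees `B > 0`, so that division by `√B` is
  -- legitimate.
  have hD : max D₀ 1 ≤ H n * √B := by
    refine le_of_sq_le_sq ?_ (mul_nonneg (hH n).le (Real.sqrt_nonneg B))
    rw [mul_pow, Real.sq_sqrt hB0]
    linarith
  have hD1 : 0 < H n * √B := lt_of_lt_of_le one_pos ((le_max_right _ _).trans hD)
  have hb : 0 < √B := pos_of_mul_pos_right hD1 (hH n).le
  have hbB : √B ^ 2 = B := Real.sq_sqrt hB0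
  have hcgf := (hS n).isAnalyticCGF (hX n) (hindep n) (hH n) (hL n) (hc n) (hLc n) (hcsum n)
  have hZ := hcgf.div_const hb
  have hSm := (hS n).aemeasurable (hX n)
  have hcum1 : cumulant 1 (S n) P = 0 := by
    rw [← (hsum n 1).tsum_eq]
    simp only [(hL n _).cumulant_one (hH n), hmean, tsum_zero]
  have hcum2 : cumulant 2 (S n) P = B := by
    rw [← (hsum n 2).tsum_eq]
    simp only [(hL n _).cumulant_two (hH n)]
    rfl
  have h0 : |(0 : ℝ)| < H n * √B := by simpa using hD1
  have hd := fun k => hZ.iteratedDeriv_ofReal k h0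
  simp only [Complex.ofReal_zero] at hd
  have key := hM (fun ω => S n ω / √B) _ (H n * √B) x (hSm.div_const _)
    ((le_max_left _ _).trans hD) hD1 hZ ?_ ?_ ?_ hx0 ?_
  -- The strict inequality in `normalizedDF` makes the complement the closed tail, matching
  -- `Set.Ici` in `expTail`; no continuity of the law is needed.
  · have hP : 1 - normalizedDF (S n) B P x = P.real {ω | x ≤ S n ω / √B} := by
      rw [normalizedDF, ← probReal_compl_eq_one_sub₀ (nullMeasurableSet_lt hSm aemeasurable_const)]
      congr 1
      ext ω
      simp [le_div_iff₀ hb]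
    have hexp : x ^ 3 / (6 * B ^ (3 / 2 : ℝ)) * ∑' j, cumulant 3 (X n j) P =
        cumulant 3 (fun ω => S n ω / √B) P * x ^ 3 / 6 := by
      have hpow : B ^ (3 / 2 : ℝ) = √B ^ 3 := by
        rw [Real.sqrt_eq_rpow, ← Real.rpow_mul_natCast hB0]
        norm_num
      rw [(hsum n 3).tsum_eq, cumulant_div_const, hpow]
      field_simp
    rw [hP, hexp]
    exact key
  · intro z hz
    have hz' : ‖((√B : ℝ) : ℂ)⁻¹ * z‖ < H n := by
      rwa [norm_mul, norm_inv, Complex.norm_real, Real.norm_of_nonneg hb.le, inv_mul_lt_iff₀ hb,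
        mul_comm]
    have hBH0 : 0 ≤ B * H n ^ 2 := by positivity
    calc _ ≤ ∑' j, c n j := tsum_of_norm_bounded (hcsum n).hasSum fun j => hLc n j _ hz'
      _ ≤ A * (B * H n ^ 2) := by
          rw [Real.norm_of_nonneg hBH0] at hAn
          exact (le_abs_self _).trans hAn
      _ ≤ max A 1 * (B * H n ^ 2) := by gcongr; exact le_max_left _ _
      _ = max A 1 * (H n * √B) ^ 2 := by rw [mul_pow, hbB]; ring
  · have h := hd 1
    rw [iteratedDeriv_one] at h
    rw [h]
    have := cumulant_div_const (P := P) (X := S n) 1 √B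
    rw [hcum1, mul_zero] at this
    exact_mod_cast this
  · have h := hd 2
    rw [h]
    have := cumulant_div_const (P := P) (X := S n) 2 √B
    rw [hcum2, inv_pow, hbB, inv_mul_cancel₀ (by rw [← hbB]; positivity)] at this
    exact_mod_cast this
  · have h1 : x ≤ |K| * (H n * √B) ^ (1 / 3 : ℝ) :=
      hxK.trans (by gcongr; exact le_abs_self K)
    calc x ^ 3 ≤ (|K| * (H n * √B) ^ (1 / 3 : ℝ)) ^ 3 := by gcongr
      _ = |K| ^ 3 * (H n * √B) := by
          rw [mul_pow, ← Real.rpow_mul_natCast hD1.le]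
          norm_num
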